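/- Let $N\in\{1,2,3\}$ and let $\Omega\subset\mathbb R^N$ be a bounded domain with $\partial\Omega\in C^4$. Let $f,g\in C^4(\overline\Omega)$ satisfy $f\le g$ in $\Omega$ and $f<0<g$ on $\partial\Omega$, and let $u_0\in H^2_0(\Omega)$ with $f\le u_0\le g$ in $\Omega$. Put $E(v)=\frac12\int_\Omega|\Delta v|^2\,dx$ and $K=\{v\in H^2_0(\Omega): f\le v\le g \text{ in }\Omega\}$. For $T>0$ and an integer $n\ge1$ let $\tau_n=T/n$, $u_{0,n}=u_0$, and for $i\ge1$ let $u_{i,n}$ be the minimizer over $v\in K$ of $$E(v)+\frac1{2\tau_n}\int_\Omega|v-u_{i-1,n}|^2\,dx .$$ Let $u_n=u_n^{T}$ be the piecewise linear interpolant on $[0,T]$, $$u_n(x,t)=u_{i-1,n}(x)+\bigl(t-(i-1)\tau_n\bigr)\frac{u_{i,n}(x)-u_{i-1,n}(x)}{\tau_n},\qquad (i-1)\tau_n\le t\le i\tau_n,\ 1\le i\le n .$$ Then there is a function $u:[0,\infty)\to L^2(\Omega)$ such that for every $T>0$ the following hold. 1. $u\in L^\infty(0,T;H^2_0(\Omega))\cap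 H^1(0,T;L^2(\Omega))$ and $$\int_0^T\!\!\int_\Omega|\partial_tu|^2\,dx\,dt\le 2E(u_0).$$ 2. For every $t\in[0,T]$, $u(\cdot,t)$ is continuous in $\Omega$ (after modification on a null set), and $f(x)\le u(x,t)\le g(x)$ for all $x\in\Omega$. 3. There is a subsequence $(u_{n_k})_k$ of $(u_n)_n=(u_n^{T})_n$ such that, as $k\to\infty$, $u_{n_k}\rightharpoonup u$ weakly in $L^2(0,T;H^2(\Omega))\cap H^1(0,T;L^2(\Omega))$ and, for every $\alpha\in(0,1/2)$, $u\in C^{0,\alpha}([0,T];L^2(\Omega))$ and $u_{n_k}\to u$ in $C^{0,\alpha}([0,T];L^2(\Omega))$. -/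

import Mathlib

open MeasureTheory Filter Topology Set
open scoped NNReal ENNReal ContDiff

namespace BiharmonicObstacle

noncomputable section

/-- The Euclidean space `ℝᴺ`. -/
abbrev Euc (N : ℕ) : Type := EuclideanSpace ℝ (Fin N)

/-- The `i`-th vector of the standard basis of `ℝᴺ`. -/
def stdVec {N : ℕ} (i : Fin N) : Euc N := EuclideanSpace.single i (1 : ℝ)

/-! ### Bounded domains and their boundary -/

/-- A bounded domain: a non-empty, open, connected and bounded set. -/
structure IsBoundedDomain {N : ℕ} (Ω : Set (Euc N)) : Prop where
  isOpen : IsOpen Ω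
  isConnected : IsConnected Ω
  isBounded : Bornology.IsBounded Ω

/-- `∂Ω ∈ C⁴`: near each boundary point, `Ω` is the sublevel set `{ρ < 0}` of a `C⁴` function `ρ`
without critical points. -/
def HasC4Boundary {N : ℕ} (Ω : Set (Euc N)) : Prop :=
  ∀ x₀ ∈ frontier Ω, ∃ (U : Set (Euc N)) (ρ : Euc N → ℝ),
    IsOpen U ∧ x₀ ∈ U ∧ ContDiffOn ℝ 4 ρ U ∧ (∀ x ∈ U, fderiv ℝ ρ x ≠ 0) ∧
      Ω ∩ U = {x ∈ U | ρ x < 0}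

/-- The conditions on the obstacles: `f, g ∈ C⁴(Ω̄)`, `f ≤ g` in `Ω` and `f < 0 < g` on `∂Ω`. -/
structure AreObstacles {N : ℕ} (Ω : Set (Euc N)) (f g : Euc N → ℝ) : Prop where
  contDiffOn_lower : ContDiffOn ℝ 4 f (closure Ω)
  contDiffOn_upper : ContDiffOn ℝ 4 g (closure Ω)
  le : ∀ x ∈ Ω, f x ≤ g x
  lower_neg : ∀ x ∈ frontier Ω, f x < 0
  upper_pos : ∀ x ∈ frontier Ω, 0 < g x

/-! ### Sobolev spaces in the space variable -/

/-- The Hilbert space `L²(Ω)`. -/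
abbrev L2 {N : ℕ} (Ω : Set (Euc N)) : Type := Lp ℝ 2 (volume.restrict Ω)

/-- Test functions: elements of `C_c^∞(Ω)`. -/
structure IsTest {N : ℕ} (Ω : Set (Euc N)) (φ : Euc N → ℝ) : Prop where
  smooth : ContDiff ℝ ∞ φ
  compact : HasCompactSupport φ
  support : tsupport φ ⊆ Ω

/-- `p` is the weak partial derivative `∂ᵢ v` in `Ω`. -/
def IsWeakPartial {N : ℕ} (Ω : Set (Euc N)) (i : Fin N) (v p : L2 Ω) : Prop :=
  ∀ φ : Euc N → ℝ, IsTest Ω φ →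
    ∫ x in Ω, v x * fderiv ℝ φ x (stdVec i) = - ∫ x in Ω, p x * φ x

theorem IsTest.integrable_mul {N : ℕ} {Ω : Set (Euc N)} {φ : Euc N → ℝ} (hφ : IsTest Ω φ)
    (v : L2 Ω) : Integrable (fun x => v x * φ x) (volume.restrict Ω) :=
  (Lp.memLp v).integrable_mul (q := 2)
    (hφ.smooth.continuous.memLp_of_hasCompactSupport hφ.compact)

theorem IsTest.integrable_mul_fderiv {N : ℕ} {Ω : Set (Euc N)} {φ : Euc N → ℝ}
    (hφ : IsTest Ω φ) (v : L2 Ω) (e : Euc N) :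
    Integrable (fun x => v x * fderiv ℝ φ x e) (volume.restrict Ω) := by
  have hc : Continuous (fun x => fderiv ℝ φ x e) :=
    (hφ.smooth.continuous_fderiv (by simp)).clm_apply continuous_const
  have hs : HasCompactSupport (fun x => fderiv ℝ φ x e) := hφ.compact.fderiv_apply ℝ e
  exact (Lp.memLp v).integrable_mul (q := 2) (hc.memLp_of_hasCompactSupport hs)

theorem IsWeakPartial.zero {N : ℕ} (Ω : Set (Euc N)) (i : Fin N) :
    IsWeakPartial Ω i 0 0 := by
  intro φ _
  have h := Lp.coeFn_zero ℝ 2 (volume.restrict Ω)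
  have h1 : ∫ x in Ω, (0 : L2 Ω) x * fderiv ℝ φ x (stdVec i) = 0 :=
    integral_eq_zero_of_ae (by filter_upwards [h] with x hx; rw [hx]; exact zero_mul _)
  have h2 : ∫ x in Ω, (0 : L2 Ω) x * φ x = 0 :=
    integral_eq_zero_of_ae (by filter_upwards [h] with x hx; rw [hx]; exact zero_mul _)
  rw [h1, h2, neg_zero]

theorem IsWeakPartial.add {N : ℕ} {Ω : Set (Euc N)} {i : Fin N} {v p w q : L2 Ω}
    (h : IsWeakPartial Ω i v p) (h' : IsWeakPartial Ω i w q) :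
    IsWeakPartial Ω i (v + w) (p + q) := by
  intro φ hφ
  have h1 : ∫ x in Ω, (v + w) x * fderiv ℝ φ x (stdVec i)
      = ∫ x in Ω, (v x * fderiv ℝ φ x (stdVec i) + w x * fderiv ℝ φ x (stdVec i)) :=
    integral_congr_ae (by
      filter_upwards [Lp.coeFn_add v w] with x hx
      rw [hx, Pi.add_apply, add_mul])
  have h2 : ∫ x in Ω, (p + q) x * φ x = ∫ x in Ω, (p x * φ x + q x * φ x) :=
    integral_congr_ae (by
      filter_upwards [Lp.coeFn_add p q] with x hx
      rw [hx, Pi.add_apply, add_mul])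
  rw [h1, h2, integral_add (hφ.integrable_mul_fderiv v _) (hφ.integrable_mul_fderiv w _),
    integral_add (hφ.integrable_mul p) (hφ.integrable_mul q), h φ hφ, h' φ hφ, neg_add]

theorem IsWeakPartial.smul {N : ℕ} {Ω : Set (Euc N)} {i : Fin N} {v p : L2 Ω} (c : ℝ)
    (h : IsWeakPartial Ω i v p) : IsWeakPartial Ω i (c • v) (c • p) := by
  intro φ hφ
  have h1 : ∫ x in Ω, (c • v) x * fderiv ℝ φ x (stdVec i)
      = ∫ x in Ω, c * (v x * fderiv ℝ φ x (stdVec i)) :=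
    integral_congr_ae (by
      filter_upwards [Lp.coeFn_smul c v] with x hx
      rw [hx, Pi.smul_apply, smul_eq_mul, mul_assoc])
  have h2 : ∫ x in Ω, (c • p) x * φ x = ∫ x in Ω, c * (p x * φ x) :=
    integral_congr_ae (by
      filter_upwards [Lp.coeFn_smul c p] with x hx
      rw [hx, Pi.smul_apply, smul_eq_mul, mul_assoc])
  rw [h1, h2, integral_const_mul, integral_const_mul, h φ hφ, mul_neg]

/-- Index set for the partial derivatives of order `0`, `1` and `2`. -/
abbrev JetIndex (N : ℕ) : Type := Unit ⊕ Fin N ⊕ (Fin N × Fin N)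

/-- The Sobolev space `H²(Ω)`, realised as the space of all `2`-jets
`(v, (∂ᵢ v)ᵢ, (∂ⱼ ∂ᵢ v)ᵢⱼ)` of weak derivatives in `L²(Ω)`, with the Hilbert norm
`‖v‖² + ∑ᵢ ‖∂ᵢ v‖² + ∑ᵢⱼ ‖∂ⱼ ∂ᵢ v‖²` (norms of `L²(Ω)`). -/
def H2 {N : ℕ} (Ω : Set (Euc N)) :
    Submodule ℝ (PiLp 2 (fun _ : JetIndex N => L2 Ω)) where
  carrier := {U | (∀ i, IsWeakPartial Ω i (U (.inl ())) (U (.inr (.inl i)))) ∧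
    ∀ i j, IsWeakPartial Ω j (U (.inr (.inl i))) (U (.inr (.inr (i, j))))}
  zero_mem' := ⟨fun i => IsWeakPartial.zero Ω i, fun _ j => IsWeakPartial.zero Ω j⟩
  add_mem' := fun h h' => ⟨fun i => (h.1 i).add (h'.1 i), fun i j => (h.2 i j).add (h'.2 i j)⟩
  smul_mem' := fun c _ h => ⟨fun i => (h.1 i).smul c, fun i j => (h.2 i j).smul c⟩

/-- The underlying function of an element of `H²(Ω)`. -/
def toL2 {N : ℕ} {Ω : Set (Euc N)} (U : H2 Ω) : L2 Ω := U.1 (.inl ())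

/-- The weak Laplacian `∑ᵢ ∂ᵢ ∂ᵢ v` of an element of `H²(Ω)`. -/
def laplacian {N : ℕ} {Ω : Set (Euc N)} (U : H2 Ω) : L2 Ω :=
  ∑ i : Fin N, U.1 (.inr (.inr (i, i)))

/-- `H²₀(Ω)`: the closure of `C_c^∞(Ω)` in `H²(Ω)`. -/
def H20 {N : ℕ} (Ω : Set (Euc N)) : Set (H2 Ω) :=
  closure {U : H2 Ω | ∃ φ : Euc N → ℝ, IsTest Ω φ ∧ toL2 U =ᵐ[volume.restrict Ω] φ}

/-! ### The minimizing movement scheme -/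

/-- `K = {v ∈ H²₀(Ω) | f ≤ v ≤ g in Ω}`. -/
def obstacleSet {N : ℕ} (Ω : Set (Euc N)) (f g : Euc N → ℝ) : Set (H2 Ω) :=
  {V | V ∈ H20 Ω ∧ ∀ᵐ x ∂(volume.restrict Ω), f x ≤ toL2 V x ∧ toL2 V x ≤ g x}

/-- `E(v) = ½ ∫_Ω |Δ v|² dx`. -/
def energy {N : ℕ} {Ω : Set (Euc N)} (V : H2 Ω) : ℝ :=
  1 / 2 * ∫ x in Ω, (laplacian V x) ^ 2

/-- `G(v) = E(v) + (2 τ)⁻¹ ∫_Ω (v - w)² dx`, where `w` is the previous step. -/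
def stepFunctional {N : ℕ} {Ω : Set (Euc N)} (τ : ℝ) (W V : H2 Ω) : ℝ :=
  energy V + 1 / (2 * τ) * ∫ x in Ω, (toL2 V x - toL2 W x) ^ 2

/-- The minimizer of `stepFunctional τ W` over `K`. -/
def stepMinimizer {N : ℕ} {Ω : Set (Euc N)} (f g : Euc N → ℝ) (τ : ℝ) (W : H2 Ω) : H2 Ω :=
  Classical.epsilon fun V =>
    V ∈ obstacleSet Ω f g ∧ ∀ V' ∈ obstacleSet Ω f g, stepFunctional τ W V ≤ stepFunctional τ W V'

/-- The iterates `u_{0}, u_{1}, u_{2}, …` of the implicit time discretization with step `τ`. -/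
def discreteSol {N : ℕ} {Ω : Set (Euc N)} (f g : Euc N → ℝ) (u₀ : H2 Ω) (τ : ℝ) : ℕ → H2 Ω
  | 0 => u₀
  | i + 1 => stepMinimizer f g τ (discreteSol f g u₀ τ i)

/-- The piecewise linear interpolant `u_n` on `[0, T]`, with `τ = T / n`: for
`t ∈ [i τ, (i + 1) τ]` it is `u_{i} + (t - i τ) τ⁻¹ (u_{i+1} - u_{i})`. -/
def interpolant {N : ℕ} {Ω : Set (Euc N)} (f g : Euc N → ℝ) (u₀ : H2 Ω) (T : ℝ) (n : ℕ)
    (t : ℝ) : L2 Ω :=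
  let τ : ℝ := T / n
  let i : ℕ := ⌊t / τ⌋₊
  let a : L2 Ω := toL2 (discreteSol f g u₀ τ i)
  let b : L2 Ω := toL2 (discreteSol f g u₀ τ (i + 1))
  a + (t - i * τ) • (τ⁻¹ • (b - a))

/-! ### Spaces of functions of time -/

/-- Lebesgue measure on `(0, T)`. -/
abbrev timeMeasure (T : ℝ) : Measure ℝ := volume.restrict (Ioo 0 T)

/-- `w` is the weak derivative in time of `v`, for `v, w ∈ L²(0, T; X)`. -/
def IsWeakTimeDeriv {X : Type*} [NormedAddCommGroup X] [NormedSpace ℝ X] (T : ℝ)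
    (v w : Lp X 2 (timeMeasure T)) : Prop :=
  ∀ η : ℝ → ℝ, ContDiff ℝ ∞ η → HasCompactSupport η → tsupport η ⊆ Ioo 0 T →
    ∫ t in Ioo 0 T, deriv η t • v t = - ∫ t in Ioo 0 T, η t • w t

theorem integrable_smul_Lp {X : Type*} [NormedAddCommGroup X] [NormedSpace ℝ X] {T : ℝ}
    {η : ℝ → ℝ} (hη : Continuous η) (hs : HasCompactSupport η) (v : Lp X 2 (timeMeasure T)) :
    Integrable (fun t => η t • v t) (timeMeasure T) :=
  memLp_one_iff_integrable.1 ((Lp.memLp v).smul (p := 2) (r := 1)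
    (hη.memLp_of_hasCompactSupport hs))

/-- `H¹(0, T; X)`, realised as the space of pairs `(v, ∂ₜ v)` in `L²(0, T; X)²`, with the norm
`(‖v‖² + ‖∂ₜ v‖²)^{1/2}`. -/
def H1Time (T : ℝ) (X : Type*) [NormedAddCommGroup X] [NormedSpace ℝ X] :
    Submodule ℝ (WithLp 2 (Lp X 2 (timeMeasure T) × Lp X 2 (timeMeasure T))) where
  carrier := {P | IsWeakTimeDeriv T P.fst P.snd}
  zero_mem' := by
    intro η _ _ _
    have h := Lp.coeFn_zero X 2 (timeMeasure T)
    have h1 : ∫ t in Ioo 0 T, deriv η t • (0 : Lp X 2 (timeMeasure T)) t = 0 :=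
      integral_eq_zero_of_ae (by filter_upwards [h] with t ht; rw [ht]; exact smul_zero _)
    have h2 : ∫ t in Ioo 0 T, η t • (0 : Lp X 2 (timeMeasure T)) t = 0 :=
      integral_eq_zero_of_ae (by filter_upwards [h] with t ht; rw [ht]; exact smul_zero _)
    rw [WithLp.zero_fst, WithLp.zero_snd, h1, h2, neg_zero]
  add_mem' := by
    intro P Q hP hQ η hη hc hs
    have hd : Continuous (deriv η) := hη.continuous_deriv (by simp)
    have h1 : ∫ t in Ioo 0 T, deriv η t • (P.fst + Q.fst) t
        = ∫ t in Ioo 0 T, (deriv η t • P.fst t + deriv η t • Q.fst t) :=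
      integral_congr_ae (by
        filter_upwards [Lp.coeFn_add P.fst Q.fst] with t ht
        rw [ht, Pi.add_apply, smul_add])
    have h2 : ∫ t in Ioo 0 T, η t • (P.snd + Q.snd) t
        = ∫ t in Ioo 0 T, (η t • P.snd t + η t • Q.snd t) :=
      integral_congr_ae (by
        filter_upwards [Lp.coeFn_add P.snd Q.snd] with t ht
        rw [ht, Pi.add_apply, smul_add])
    rw [WithLp.add_fst, WithLp.add_snd, h1, h2,
      integral_add (integrable_smul_Lp hd hc.deriv _) (integrable_smul_Lp hd hc.deriv _),
      integral_add (integrable_smul_Lp hη.continuous hc _)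
        (integrable_smul_Lp hη.continuous hc _),
      hP η hη hc hs, hQ η hη hc hs, neg_add]
  smul_mem' := by
    intro c P hP η hη hc hs
    have h1 : ∫ t in Ioo 0 T, deriv η t • (c • P.fst) t
        = ∫ t in Ioo 0 T, c • (deriv η t • P.fst t) :=
      integral_congr_ae (by
        filter_upwards [Lp.coeFn_smul c P.fst] with t ht
        rw [ht, Pi.smul_apply, smul_comm])
    have h2 : ∫ t in Ioo 0 T, η t • (c • P.snd) t = ∫ t in Ioo 0 T, c • (η t • P.snd t) :=
      integral_congr_ae (by
        filter_upwards [Lp.coeFn_smul c P.snd] with t ht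
        rw [ht, Pi.smul_apply, smul_comm])
    rw [WithLp.smul_fst, WithLp.smul_snd, h1, h2, integral_smul, integral_smul,
      hP η hη hc hs, smul_neg]

/-- `P ∈ H¹(0, T; X)` is the class of the function `v`. -/
def IsClassOfH1Time {T : ℝ} {X : Type*} [NormedAddCommGroup X] [NormedSpace ℝ X]
    (P : H1Time T X) (v : ℝ → X) : Prop :=
  P.1.fst =ᵐ[timeMeasure T] v

/-- The weak time derivative of an element of `H¹(0, T; X)`. -/
def timeDeriv {T : ℝ} {X : Type*} [NormedAddCommGroup X] [NormedSpace ℝ X]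
    (P : H1Time T X) : Lp X 2 (timeMeasure T) := P.1.snd

/-- `Q ∈ L²(0, T; H²(Ω))` is the class of the function `v : ℝ → L²(Ω)`. -/
def IsClassOfL2H2 {N : ℕ} {Ω : Set (Euc N)} {T : ℝ} (Q : Lp (H2 Ω) 2 (timeMeasure T))
    (v : ℝ → L2 Ω) : Prop :=
  ∀ᵐ t ∂(timeMeasure T), toL2 (Q t) = v t

/-- `v ∈ L^∞(0, T; H²₀(Ω))`. -/
def MemLinftyH20 {N : ℕ} {Ω : Set (Euc N)} (T : ℝ) (v : ℝ → L2 Ω) : Prop :=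
  ∃ V : ℝ → H2 Ω, MemLp V ∞ (timeMeasure T) ∧
    ∀ᵐ t ∂(timeMeasure T), V t ∈ H20 Ω ∧ toL2 (V t) = v t

/-- Weak convergence of a sequence in a normed space. -/
def WeaklyTendsto {B : Type*} [NormedAddCommGroup B] [NormedSpace ℝ B] (b : ℕ → B) (b' : B) :
    Prop :=
  ∀ ℓ : B →L[ℝ] ℝ, Tendsto (fun k => ℓ (b k)) atTop (𝓝 (ℓ b'))

/-- Weak convergence `v_k ⇀ v` in `L²(0, T; H²(Ω))` (including membership of all functions). -/
def WeaklyTendstoL2H2 {N : ℕ} {Ω : Set (Euc N)} (T : ℝ) (v : ℕ → ℝ → L2 Ω) (v' : ℝ → L2 Ω) :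
    Prop :=
  ∃ (Q : ℕ → Lp (H2 Ω) 2 (timeMeasure T)) (Q' : Lp (H2 Ω) 2 (timeMeasure T)),
    (∀ k, IsClassOfL2H2 (Q k) (v k)) ∧ IsClassOfL2H2 Q' v' ∧ WeaklyTendsto Q Q'

/-- Weak convergence `v_k ⇀ v` in `H¹(0, T; X)` (including membership of all functions). -/
def WeaklyTendstoH1Time {X : Type*} [NormedAddCommGroup X] [NormedSpace ℝ X] (T : ℝ)
    (v : ℕ → ℝ → X) (v' : ℝ → X) : Prop :=
  ∃ (P : ℕ → H1Time T X) (P' : H1Time T X),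
    (∀ k, IsClassOfH1Time (P k) (v k)) ∧ IsClassOfH1Time P' v' ∧ WeaklyTendsto P P'

/-- The norm of `C^{0,α}([0, T]; X)`, with value `∞` off that space. -/
def holderNormOn {X : Type*} [NormedAddCommGroup X] (T : ℝ) (α : ℝ≥0) (v : ℝ → X) : ℝ≥0∞ :=
  (⨆ t : Icc (0 : ℝ) T, ‖v t‖ₑ) + eHolderNorm α (fun t : Icc (0 : ℝ) T => v t)

end

end BiharmonicObstacle

open BiharmonicObstacle

/-! The scheme is the implicit Euler scheme for the gradient flow in `L²` of the convex energy `E`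
on the closed convex set `K`. The proof uses this convexity and no compactness: the discrete
solutions form a Cauchy family as the time step tends to `0`.

The minimality of `u_{i+1}` is equivalent to a projection problem in a Hilbert space, whose
variational inequality gives, for all `V ∈ K`, `E(u_{i+1}) ≤ E(V) + ⟨(u_{i+1} - u_i)/τ, V -
u_{i+1}⟩`. The choice `V = u_i` gives energy dissipation, `‖∂ₜu_n‖² ≤ -(d/dt) E_n` with `E_n` the
linear interpolant of the energies. Hence the bounds in `H¹(0,T;L²)` and `C^{0,1/2}`. Choosing for
`V` an iterate of a second flow, with another step `σ`, and adding the two inequalities makes the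
energies cancel. The interpolants `v`, `w` of the two flows then satisfy `‖v(t) - w(t)‖² ≤
8(τ+σ)E(u₀)` (`IsDiscreteFlow.norm_sq_linearInterp_sub_le`). So the whole family converges uniformly
in time in `L²`, to a limit that does not depend on `T`.

All remaining modes of convergence follow from this one. A bounded sequence in a Hilbert space whose
image under an injective operator converges is weakly convergent
(`exists_weaklyTendsto_of_injective`); this is applied in `H²`, `L²(0,T;H²)` and `H¹(0,T;L²)`.
Convergence in `C^{0,α}` is interpolation between uniform convergence and the `C^{0,1/2}` bounds.

The facts about `H²₀(Ω)` needed are coercivity, from `∫|D²φ|² = ∫|Δφ|²` for test functions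
(`norm_sq_le_of_mem_H20`), and the embedding in continuous functions for `N ≤ 3`, proved by the
Fourier transform (`exists_continuous_ae_eq_of_mem_H20`). -/

namespace BiharmonicObstacle

/-! ### Weak limits in Hilbert spaces -/

section WeakLimits

variable {H Y : Type*} [NormedAddCommGroup H] [InnerProductSpace ℝ H] [CompleteSpace H]
  [NormedAddCommGroup Y] [InnerProductSpace ℝ Y] [CompleteSpace Y]

/-- The orthogonal complement of the range of `A*` is the kernel of `A`. -/
theorem denseRange_adjoint_of_injective (A : H →L[ℝ] Y) (hA : Function.Injective A) :
    DenseRange (ContinuousLinearMap.adjoint A) := by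
  have h : ((ContinuousLinearMap.adjoint A).range).topologicalClosure = ⊤ := by
    rw [Submodule.topologicalClosure_eq_top_iff, Submodule.eq_bot_iff]
    intro x hx
    apply hA
    rw [map_zero]
    refine ext_inner_left ℝ fun y => ?_
    rw [inner_zero_right, ← ContinuousLinearMap.adjoint_inner_left]
    exact hx _ ⟨y, rfl⟩
  intro x
  have hx : x ∈ ((ContinuousLinearMap.adjoint A).range).topologicalClosure := by rw [h]; trivial
  exact hx

/-- A bounded sequence in a Hilbert space whose image under an injective bounded operator converges
is weakly convergent. -/
theorem exists_weaklyTendsto_of_injective (A : H →L[ℝ] Y) (hA : Function.Injective A)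
    {b : ℕ → H} {C : ℝ} (hb : ∀ k, ‖b k‖ ≤ C) {y : Y}
    (hy : Tendsto (fun k => A (b k)) atTop (𝓝 y)) :
    ∃ b' : H, A b' = y ∧ WeaklyTendsto b b' := by
  have hC : 0 ≤ C := (norm_nonneg _).trans (hb 0)
  have hlim : ∀ h : H, ∃ c : ℝ, Tendsto (fun k => inner ℝ (b k) h) atTop (𝓝 c) := by
    intro h
    refine cauchySeq_tendsto_of_complete (Metric.cauchySeq_iff.2 fun ε hε => ?_)
    -- Against a vector `A* z` the pairing is `⟨A b_k, z⟩`, which converges. Such vectors are dense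
    -- and `b` is bounded, so the pairing with `h` is Cauchy. The summand in `C + 1` only keeps the
    -- denominator positive.
    obtain ⟨z, hz⟩ := (denseRange_adjoint_of_injective A hA).exists_dist_lt h
      (show 0 < ε / (3 * (C + 1)) by positivity)
    have hc : CauchySeq fun k => inner ℝ (A (b k)) z := (hy.inner tendsto_const_nhds).cauchySeq
    obtain ⟨M, hM⟩ := Metric.cauchySeq_iff.1 hc (ε / 3) (by positivity)
    have key : ∀ k, |inner ℝ (b k) h - inner ℝ (A (b k)) z| < ε / 3 := by
      intro k
      rw [← ContinuousLinearMap.adjoint_inner_right, ← inner_sub_right]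
      refine (abs_real_inner_le_norm _ _).trans_lt ?_
      rw [dist_eq_norm, lt_div_iff₀ (by positivity)] at hz
      have := mul_le_mul_of_nonneg_right (hb k) (norm_nonneg (h - ContinuousLinearMap.adjoint A z))
      nlinarith [norm_nonneg (h - ContinuousLinearMap.adjoint A z)]
    refine ⟨M, fun m hm n hn => ?_⟩
    have h1 := hM m hm n hn
    rw [Real.dist_eq] at h1 ⊢
    have h2 := abs_lt.1 (key m)
    have h3 := abs_lt.1 (key n)
    have h4 := abs_lt.1 h1
    rw [abs_lt]
    constructor <;> linarith [h2.1, h2.2, h3.1, h3.2, h4.1, h4.2]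
  choose c hc using hlim
  -- The pointwise limit of the functionals is bounded by Banach–Steinhaus; its Riesz representative
  -- is the weak limit.
  let F : H →L[ℝ] ℝ := continuousLinearMapOfTendsto (σ₁₂ := RingHom.id ℝ)
    (fun k => innerSL ℝ (b k)) (f := c)
    (tendsto_pi_nhds.2 fun h => by simpa using hc h)
  have hF : ∀ h, inner ℝ ((InnerProductSpace.toDual ℝ H).symm F) h = c h := fun h => by
    rw [InnerProductSpace.toDual_symm_apply]; rfl
  have hweak : ∀ h, Tendsto (fun k => inner ℝ (b k) h) atTop
      (𝓝 (inner ℝ ((InnerProductSpace.toDual ℝ H).symm F) h)) := fun h => by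
    rw [hF]; exact hc h
  refine ⟨(InnerProductSpace.toDual ℝ H).symm F, ?_, fun ℓ => ?_⟩
  · refine ext_inner_right ℝ fun z => ?_
    rw [← ContinuousLinearMap.adjoint_inner_right]
    refine tendsto_nhds_unique (hweak _) ?_
    simp_rw [ContinuousLinearMap.adjoint_inner_right]
    exact hy.inner tendsto_const_nhds
  · have h := hweak ((InnerProductSpace.toDual ℝ H).symm ℓ)
    simp_rw [real_inner_comm ((InnerProductSpace.toDual ℝ H).symm ℓ),
      InnerProductSpace.toDual_symm_apply] at h
    exact h

theorem WeaklyTendsto.norm_map_le {B F : Type*} [NormedAddCommGroup B] [NormedSpace ℝ B]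
    [NormedAddCommGroup F] [InnerProductSpace ℝ F] {b : ℕ → B} {b' : B}
    (h : WeaklyTendsto b b') (A : B →L[ℝ] F) {C : ℝ} (hC : ∀ k, ‖A (b k)‖ ≤ C) :
    ‖A b'‖ ≤ C := by
  have h1 := h ((innerSL ℝ (A b')).comp A)
  simp only [ContinuousLinearMap.comp_apply, innerSL_apply_apply] at h1
  have h2 : inner ℝ (A b') (A b') ≤ ‖A b'‖ * C := le_of_tendsto h1 <| Eventually.of_forall fun k =>
    (real_inner_le_norm _ _).trans (mul_le_mul_of_nonneg_left (hC k) (norm_nonneg _))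
  rw [real_inner_self_eq_norm_sq] at h2
  have hC0 : 0 ≤ C := (norm_nonneg _).trans (hC 0)
  by_contra! hlt
  nlinarith [norm_nonneg (A b')]

/-- Mazur: a functional separating `b'` from `K` would contradict weak convergence. -/
theorem WeaklyTendsto.mem_of_isClosed_convex {B : Type*} [NormedAddCommGroup B] [NormedSpace ℝ B]
    {b : ℕ → B} {b' : B} (h : WeaklyTendsto b b') {K : Set B} (hK : IsClosed K)
    (hc : Convex ℝ K) (hb : ∀ k, b k ∈ K) : b' ∈ K := by
  by_contra hn
  obtain ⟨ℓ, s, h1, h2⟩ := geometric_hahn_banach_closed_point hc hK hn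
  have : ℓ b' ≤ s := le_of_tendsto (h ℓ) (Eventually.of_forall fun k => (h1 _ (hb k)).le)
  linarith

end WeakLimits

/-! ### Piecewise linear interpolation in time -/

noncomputable section LinearInterpolation

variable {X Z : Type*} [NormedAddCommGroup X] [NormedSpace ℝ X] [NormedAddCommGroup Z]
  [NormedSpace ℝ Z]

/-- The slope at time `t` of the piecewise linear interpolant of `a` with mesh `τ`. -/
def stepSlope (τ : ℝ) (a : ℕ → X) (t : ℝ) : X :=
  τ⁻¹ • (a (⌊t / τ⌋₊ + 1) - a ⌊t / τ⌋₊)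

/-- The piecewise linear function with value `a i` at time `i τ`. -/
def linearInterp (τ : ℝ) (a : ℕ → X) (t : ℝ) : X :=
  a ⌊t / τ⌋₊ + (t - ⌊t / τ⌋₊ * τ) • stepSlope τ a t

theorem map_stepSlope (L : X →ₗ[ℝ] Z) (τ : ℝ) (a : ℕ → X) (t : ℝ) :
    L (stepSlope τ a t) = stepSlope τ (fun i => L (a i)) t := by
  simp [stepSlope]

theorem map_linearInterp (L : X →ₗ[ℝ] Z) (τ : ℝ) (a : ℕ → X) (t : ℝ) :
    L (linearInterp τ a t) = linearInterp τ (fun i => L (a i)) t := by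
  simp [linearInterp, map_stepSlope]

theorem floor_mul_le {τ t : ℝ} (hτ : 0 < τ) (ht : 0 ≤ t) : ⌊t / τ⌋₊ * τ ≤ t :=
  (le_div_iff₀ hτ).1 (Nat.floor_le (by positivity))

theorem lt_floor_add_one_mul {τ : ℝ} (hτ : 0 < τ) (t : ℝ) : t < (⌊t / τ⌋₊ + 1) * τ :=
  (div_lt_iff₀ hτ).1 (Nat.lt_floor_add_one _)

theorem floor_div_eq {τ t : ℝ} (hτ : 0 < τ) {i : ℕ} (h1 : i * τ ≤ t) (h2 : t < (i + 1) * τ) :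
    ⌊t / τ⌋₊ = i :=
  (Nat.floor_eq_iff (div_nonneg (le_trans (by positivity) h1) hτ.le)).2
    ⟨(le_div_iff₀ hτ).2 h1, (div_lt_iff₀ hτ).2 h2⟩

theorem linearInterp_zero (τ : ℝ) (a : ℕ → X) : linearInterp τ a 0 = a 0 := by
  simp [linearInterp]

theorem linearInterp_eq_of_mem_Icc {τ t : ℝ} (hτ : 0 < τ) (a : ℕ → X) {i : ℕ}
    (ht : t ∈ Icc (i * τ) ((i + 1) * τ)) :
    linearInterp τ a t = a i + (t - i * τ) • (τ⁻¹ • (a (i + 1) - a i)) := by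
  rcases ht.2.lt_or_eq with h | h
  · rw [linearInterp, stepSlope, floor_div_eq hτ ht.1 h]
  -- At the right end of the interval the floor has already jumped to `i + 1`; both formulas give `a
  -- (i + 1)`.
  · have hf : ⌊t / τ⌋₊ = i + 1 := by
      apply floor_div_eq hτ <;> push_cast <;> nlinarith
    rw [linearInterp, hf, h, smul_smul]
    have h1 : ((i + 1) * τ - i * τ) * τ⁻¹ = 1 := by field_simp; ring
    rw [h1]
    push_cast
    simp

/-- Expansion about the right node, because the variational inequality involves the new iterate. -/
theorem linearInterp_eq_sub {τ t : ℝ} (hτ : 0 < τ) (a : ℕ → X) :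
    linearInterp τ a t = a (⌊t / τ⌋₊ + 1) - ((⌊t / τ⌋₊ + 1) * τ - t) • stepSlope τ a t := by
  have h : a (⌊t / τ⌋₊ + 1) = a ⌊t / τ⌋₊ + τ • stepSlope τ a t := by
    rw [stepSlope, smul_smul, mul_inv_cancel₀ hτ.ne', one_smul]; abel
  rw [linearInterp, h]
  module

theorem continuousOn_linearInterp {τ : ℝ} (hτ : 0 < τ) (a : ℕ → X) :
    ContinuousOn (linearInterp τ a) (Ici 0) := by
  have h : ∀ n : ℕ, ContinuousOn (linearInterp τ a) (Icc 0 (n * τ)) := by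
    intro n
    induction n with
    | zero => simp
    | succ n ih =>
      have h1 : Icc 0 (((n + 1 : ℕ) : ℝ) * τ) = Icc 0 (n * τ) ∪ Icc (n * τ) ((n + 1) * τ) := by
        rw [Icc_union_Icc_eq_Icc (by positivity) (by nlinarith)]
        push_cast; rfl
      rw [h1]
      refine ih.union_of_isClosed ?_ isClosed_Icc isClosed_Icc
      refine ContinuousOn.congr ?_ fun t ht => linearInterp_eq_of_mem_Icc hτ a ht
      fun_prop
  intro t ht
  have hn : t < (⌊t / τ⌋₊ + 1 : ℕ) * τ := by exact_mod_cast lt_floor_add_one_mul hτ t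
  refine ((h (⌊t / τ⌋₊ + 1)) t ⟨ht, hn.le⟩).mono_of_mem_nhdsWithin ?_
  rw [← Ici_inter_Iic]
  exact inter_mem self_mem_nhdsWithin (mem_nhdsWithin_of_mem_nhds (Iic_mem_nhds hn))

/-- The floor selects the slope to the right of a node, so the right derivative exists at every
time. The estimates below are comparison principles for right derivatives, with no exceptional
nodes. -/
theorem hasDerivWithinAt_linearInterp {τ t : ℝ} (hτ : 0 < τ) (a : ℕ → X) (ht : 0 ≤ t) :
    HasDerivWithinAt (linearInterp τ a) (stepSlope τ a t) (Ici t) t := by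
  set i := ⌊t / τ⌋₊ with hi
  have h : HasDerivAt (fun s : ℝ => a i + (s - i * τ) • stepSlope τ a t) (stepSlope τ a t) t := by
    simpa using (((hasDerivAt_id t).sub_const ((i : ℝ) * τ)).smul_const
      (stepSlope τ a t)).const_add (a i)
  refine h.hasDerivWithinAt.congr_of_eventuallyEq ?_ rfl
  have hmem : Ico t ((i + 1) * τ) ∈ 𝓝[≥] t := Ico_mem_nhdsGE (lt_floor_add_one_mul hτ t)
  filter_upwards [hmem] with s hs
  rw [linearInterp, stepSlope, floor_div_eq hτ ((floor_mul_le hτ ht).trans hs.1) hs.2]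
  rfl

theorem linearInterp_mem_of_convex {τ t : ℝ} (hτ : 0 < τ) (ht : 0 ≤ t) {a : ℕ → X} {K : Set X}
    (hK : Convex ℝ K) (ha : ∀ i, a i ∈ K) : linearInterp τ a t ∈ K := by
  rw [linearInterp, stepSlope, smul_smul]
  refine hK.add_smul_sub_mem (ha _) (ha _) ⟨?_, ?_⟩
  · have := floor_mul_le hτ ht
    exact mul_nonneg (by linarith) (by positivity)
  · have := lt_floor_add_one_mul hτ t
    rw [← div_eq_mul_inv, div_le_one hτ]
    linarith

theorem stronglyMeasurable_stepSlope (τ : ℝ) (a : ℕ → X) :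
    StronglyMeasurable (stepSlope τ a) :=
  (StronglyMeasurable.of_discrete (f := fun i : ℕ => τ⁻¹ • (a (i + 1) - a i))).comp_measurable
    (Nat.measurable_floor.comp (measurable_id.div_const τ))

theorem exists_norm_stepSlope_le {τ : ℝ} (hτ : 0 < τ) (a : ℕ → X) (T : ℝ) :
    ∃ C, ∀ t ≤ T, ‖stepSlope τ a t‖ ≤ C := by
  refine ⟨∑ i ∈ Finset.range (⌊T / τ⌋₊ + 1), ‖τ⁻¹ • (a (i + 1) - a i)‖, fun t ht => ?_⟩
  refine Finset.single_le_sum (f := fun i => ‖τ⁻¹ • (a (i + 1) - a i)‖)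
    (fun i _ => norm_nonneg _) (Finset.mem_range.2 (Nat.lt_succ_of_le ?_))
  exact Nat.floor_mono (div_le_div_of_nonneg_right ht hτ.le)

end LinearInterpolation

/-! ### Discrete evolution variational inequalities and their limit -/

noncomputable section DiscreteEvolution

variable {H X : Type*} [NormedAddCommGroup X] [InnerProductSpace ℝ X]

/-- The sequence `a` in `K` solves, with time step `τ`, the discrete evolution variational
inequality for the gradient flow of the convex energy `E` on `K`, with respect to the metric of `X`
pulled back by `J`. -/
structure IsDiscreteFlow (K : Set H) (J : H → X) (E : H → ℝ) (τ : ℝ) (a : ℕ → H) : Prop where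
  mem : ∀ i, a i ∈ K
  evi : ∀ i, ∀ V ∈ K,
    E (a (i + 1)) ≤ E V + inner ℝ (τ⁻¹ • (J (a (i + 1)) - J (a i))) (J V - J (a (i + 1)))

variable {K : Set H} {J : H → X} {E : H → ℝ} {τ σ : ℝ} {a b : ℕ → H}

namespace IsDiscreteFlow

/-- The previous iterate is the competitor. The variational inequality gives the full square here;
comparing the values of the minimized functional would give only half of it. -/
theorem norm_sq_stepSlope_le (h : IsDiscreteFlow K J E τ a) (hτ : 0 < τ) (t : ℝ) :
    ‖stepSlope τ (fun i => J (a i)) t‖ ^ 2 ≤ -stepSlope τ (fun i => E (a i)) t := by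
  set i := ⌊t / τ⌋₊ with hi
  have h1 := h.evi i (a i) (h.mem i)
  simp only [stepSlope, ← hi]
  rw [← neg_sub (J (a (i + 1))) (J (a i)), inner_neg_right, real_inner_smul_left, real_inner_self_eq_norm_sq] at h1
  rw [norm_smul, mul_pow, Real.norm_of_nonneg (by positivity), smul_eq_mul]
  have h2 := mul_le_mul_of_nonneg_left h1 (show 0 ≤ τ⁻¹ by positivity)
  nlinarith

theorem energy_le (h : IsDiscreteFlow K J E τ a) (hτ : 0 < τ) (i : ℕ) : E (a i) ≤ E (a 0) := by
  induction i with
  | zero => exact le_rfl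
  | succ i ih =>
    have h1 := h.evi i (a i) (h.mem i)
    rw [← neg_sub (J (a (i + 1))) (J (a i)), inner_neg_right, real_inner_smul_left, real_inner_self_eq_norm_sq] at h1
    have : 0 ≤ τ⁻¹ * ‖J (a (i + 1)) - J (a i)‖ ^ 2 := by positivity
    linarith

theorem energy_interp_nonneg (hE : ∀ V, 0 ≤ E V) (hτ : 0 < τ) {t : ℝ} (ht : 0 ≤ t) :
    0 ≤ linearInterp τ (fun i => E (a i)) t :=
  linearInterp_mem_of_convex (a := fun i => E (a i)) (K := Ici 0) hτ ht (convex_Ici 0)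
    fun i => hE (a i)

theorem energy_interp_le (h : IsDiscreteFlow K J E τ a) (hτ : 0 < τ) {t : ℝ} (ht : 0 ≤ t) :
    linearInterp τ (fun i => E (a i)) t ≤ E (a 0) :=
  linearInterp_mem_of_convex (K := Iic (E (a 0))) hτ ht (convex_Iic _) fun i => h.energy_le hτ i

/-- With `d` the norm of the slope and `l = √(t - s)`, Young's inequality `d ≤ 1/(2l) + (l/2) d²`
and dissipation bound the speed by the derivative of an explicit function, whose increment on `[s,
t]` is `l/2 + (l/2)(e s - e t)`. -/
theorem norm_linearInterp_sub_le (h : IsDiscreteFlow K J E τ a) (hE : ∀ V, 0 ≤ E V) (hτ : 0 < τ)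
    {s t : ℝ} (hs : 0 ≤ s) (hst : s ≤ t) :
    ‖linearInterp τ (fun i => J (a i)) t - linearInterp τ (fun i => J (a i)) s‖
      ≤ (1 + E (a 0)) / 2 * √(t - s) := by
  rcases hst.eq_or_lt with rfl | hlt
  · simp
  set l := √(t - s) with hl
  have hl0 : 0 < l := Real.sqrt_pos.2 (by linarith)
  have hl2 : l ^ 2 = t - s := Real.sq_sqrt (by linarith)
  set e := linearInterp τ (fun i => E (a i)) with he
  have hIcc : Icc s t ⊆ Ici 0 := fun x hx => hs.trans hx.1
  have key := image_norm_le_of_norm_deriv_right_le_deriv_boundary'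
    (f := fun r => linearInterp τ (fun i => J (a i)) r - linearInterp τ (fun i => J (a i)) s)
    (f' := stepSlope τ (fun i => J (a i))) (a := s) (b := t)
    (((continuousOn_linearInterp hτ _).mono hIcc).sub continuousOn_const)
    (fun x hx => (hasDerivWithinAt_linearInterp hτ _ (hs.trans hx.1)).sub_const _)
    (B := fun r => (r - s) / (2 * l) + l / 2 * (e s - e r))
    (B' := fun r => 1 / (2 * l) + l / 2 * (0 - stepSlope τ (fun i => E (a i)) r))
    (by simp)
    (by
      have := (continuousOn_linearInterp hτ (fun i => E (a i))).mono hIcc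
      fun_prop)
    (fun x hx => ((((hasDerivWithinAt_id x _).sub_const s).div_const (2 * l)).add
      (((hasDerivWithinAt_const x _ (e s)).sub
        (hasDerivWithinAt_linearInterp hτ _ (hs.trans hx.1))).const_mul (l / 2))))
    (fun x hx => by
      have h1 := h.norm_sq_stepSlope_le hτ x
      set d := ‖stepSlope τ (fun i => J (a i)) x‖
      have h2 : 0 ≤ (1 - l * d) ^ 2 / (2 * l) := by positivity
      have h3 : (1 - l * d) ^ 2 / (2 * l) = 1 / (2 * l) - d + l / 2 * d ^ 2 := by
        field_simp; ring
      nlinarith)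
    (right_mem_Icc.2 hst)
  refine key.trans ?_
  have h1 : 0 ≤ e t := energy_interp_nonneg hE hτ (hs.trans hst)
  have h2 : e s ≤ E (a 0) := h.energy_interp_le hτ hs
  have h3 : (t - s) / (2 * l) = l / 2 := by rw [← hl2]; field_simp
  rw [h3]
  nlinarith

/-- Approximate monotonicity. Each flow is tested with the new iterate of the other, and the
energies cancel in the sum. Replacing new iterates by interpolants costs `r D` and `r' D'`, where
`D`, `D'` are the slopes, `r ≤ τ` and `r' ≤ σ`; this is an error quadratic in the slopes. -/
theorem inner_stepSlope_sub_le (h : IsDiscreteFlow K J E τ a) (h' : IsDiscreteFlow K J E σ b)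
    (hτ : 0 < τ) (hσ : 0 < σ) {t : ℝ} (ht : 0 ≤ t) :
    inner ℝ (linearInterp τ (fun i => J (a i)) t - linearInterp σ (fun i => J (b i)) t)
      (stepSlope τ (fun i => J (a i)) t - stepSlope σ (fun i => J (b i)) t)
      ≤ 2 * (τ + σ) * (‖stepSlope τ (fun i => J (a i)) t‖ ^ 2
        + ‖stepSlope σ (fun i => J (b i)) t‖ ^ 2) := by
  have h1 := h.evi ⌊t / τ⌋₊ _ (h'.mem (⌊t / σ⌋₊ + 1))
  have h2 := h'.evi ⌊t / σ⌋₊ _ (h.mem (⌊t / τ⌋₊ + 1))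
  rw [linearInterp_eq_sub hτ, linearInterp_eq_sub hσ]
  have hr := floor_mul_le hτ ht
  have hr' := floor_mul_le hσ ht
  have hs := lt_floor_add_one_mul hτ t
  have hs' := lt_floor_add_one_mul hσ t
  change _ ≤ _ + inner ℝ (stepSlope τ (fun i => J (a i)) t) _ at h1
  change _ ≤ _ + inner ℝ (stepSlope σ (fun i => J (b i)) t) _ at h2
  set D := stepSlope τ (fun i => J (a i)) t
  set D' := stepSlope σ (fun i => J (b i)) t
  set r := (⌊t / τ⌋₊ + 1) * τ - t with hrdef
  set r' := (⌊t / σ⌋₊ + 1) * σ - t with hrdef'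
  set A := J (a (⌊t / τ⌋₊ + 1))
  set B := J (b (⌊t / σ⌋₊ + 1))
  have e1 : inner ℝ (A - r • D - (B - r' • D')) (D - D')
      = inner ℝ D (A - B) + inner ℝ D' (B - A)
        - r * ‖D‖ ^ 2 - r' * ‖D'‖ ^ 2 + (r + r') * inner ℝ D D' := by
    simp only [inner_sub_left, inner_sub_right, real_inner_smul_left, real_inner_self_eq_norm_sq,
      real_inner_comm D A, real_inner_comm D B, real_inner_comm D' A, real_inner_comm D' B,
      real_inner_comm D D']
    ring
  have e2 : inner ℝ D (A - B) = - inner ℝ D (B - A) := by rw [← inner_neg_right, neg_sub]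
  have e3 : inner ℝ D' (B - A) = - inner ℝ D' (A - B) := by rw [← inner_neg_right, neg_sub]
  have hc := real_inner_le_norm D D'
  have hr0 : 0 ≤ r := by linarith
  have hr0' : 0 ≤ r' := by linarith
  have hrτ : r ≤ τ := by rw [hrdef]; linarith
  have hrσ : r' ≤ σ := by rw [hrdef']; linarith
  rw [e1, e2, e3]
  have h3 : (r + r') * inner ℝ D D' ≤ (τ + σ) * (‖D‖ ^ 2 + ‖D'‖ ^ 2) := by
    have : inner ℝ D D' ≤ ‖D‖ ^ 2 + ‖D'‖ ^ 2 := by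
      nlinarith [sq_nonneg (‖D‖ - ‖D'‖), sq_nonneg ‖D‖, sq_nonneg ‖D'‖]
    calc (r + r') * inner ℝ D D' ≤ (r + r') * (‖D‖ ^ 2 + ‖D'‖ ^ 2) := by gcongr
      _ ≤ _ := by gcongr
  have h4 : 0 ≤ (τ + σ) * (‖D‖ ^ 2 + ‖D'‖ ^ 2) := by positivity
  have h5 : 0 ≤ r * ‖D‖ ^ 2 := by positivity
  have h6 : 0 ≤ r' * ‖D'‖ ^ 2 := by positivity
  linarith

theorem norm_sq_linearInterp_sub_le (h : IsDiscreteFlow K J E τ a)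
    (h' : IsDiscreteFlow K J E σ b) (hE : ∀ V, 0 ≤ E V) (hτ : 0 < τ) (hσ : 0 < σ)
    (hab : a 0 = b 0) {t : ℝ} (ht : 0 ≤ t) :
    ‖linearInterp τ (fun i => J (a i)) t - linearInterp σ (fun i => J (b i)) t‖ ^ 2
      ≤ 8 * (τ + σ) * E (a 0) := by
  set ea := linearInterp τ (fun i => E (a i)) with hea
  set eb := linearInterp σ (fun i => E (b i)) with heb
  have hIcc : Icc 0 t ⊆ Ici 0 := fun x hx => hx.1
  have ca := (continuousOn_linearInterp hτ (fun i => E (a i))).mono hIcc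
  have cb := (continuousOn_linearInterp hσ (fun i => E (b i))).mono hIcc
  have cw := ((continuousOn_linearInterp hτ (fun i => J (a i))).mono hIcc).sub
    ((continuousOn_linearInterp hσ (fun i => J (b i))).mono hIcc)
  -- The squared distance plus `4(τ+σ)` times the sum of the interpolated energies is nonincreasing:
  -- dissipation absorbs the quadratic error. Its initial value is `8(τ+σ)E(a 0)`.
  have key := image_le_of_deriv_right_le_deriv_boundary
    (f := fun x =>
      ‖linearInterp τ (fun i => J (a i)) x - linearInterp σ (fun i => J (b i)) x‖ ^ 2
        + 4 * (τ + σ) * (ea x + eb x))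
    (f' := fun x =>
      2 * inner ℝ (linearInterp τ (fun i => J (a i)) x - linearInterp σ (fun i => J (b i)) x)
        (stepSlope τ (fun i => J (a i)) x - stepSlope σ (fun i => J (b i)) x)
        + 4 * (τ + σ) * (stepSlope τ (fun i => E (a i)) x + stepSlope σ (fun i => E (b i)) x))
    (a := 0) (b := t) ((cw.norm.pow 2).add (continuousOn_const.mul (ca.add cb)))
    (fun x hx => by
      have d1 := (hasDerivWithinAt_linearInterp hτ (fun i => J (a i)) hx.1).sub
        (hasDerivWithinAt_linearInterp hσ (fun i => J (b i)) hx.1)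
      have d2 := (hasDerivWithinAt_linearInterp hτ (fun i => E (a i)) hx.1).add
        (hasDerivWithinAt_linearInterp hσ (fun i => E (b i)) hx.1)
      exact d1.norm_sq.add (d2.const_mul _))
    (B := fun _ => 8 * (τ + σ) * E (a 0)) (B' := fun _ => 0)
    (by
      simp only [hea, heb, linearInterp_zero, hab]
      simp only [sub_self, norm_zero]
      nlinarith)
    continuousOn_const (fun x _ => hasDerivWithinAt_const _ _ _)
    (fun x hx => by
      have i1 := h.inner_stepSlope_sub_le h' hτ hσ hx.1
      have i2 := h.norm_sq_stepSlope_le hτ x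
      have i3 := h'.norm_sq_stepSlope_le hσ x
      have i4 : 0 ≤ 4 * (τ + σ) := by positivity
      nlinarith [mul_le_mul_of_nonneg_left (add_le_add i2 i3) i4])
    (right_mem_Icc.2 ht)
  have h1 : 0 ≤ ea t := energy_interp_nonneg hE hτ ht
  have h2 : 0 ≤ eb t := energy_interp_nonneg hE hσ ht
  have h3 : 0 ≤ 4 * (τ + σ) * (ea t + eb t) := by positivity
  linarith

theorem integrableOn_norm_sq_stepSlope (hτ : 0 < τ) (T : ℝ) (x : ℕ → X) :
    IntegrableOn (fun t => ‖stepSlope τ x t‖ ^ 2) (Icc 0 T) := by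
  obtain ⟨C, hC⟩ := exists_norm_stepSlope_le hτ x T
  refine Measure.integrableOn_of_bounded (M := C ^ 2) (by simp)
    ((stronglyMeasurable_stepSlope τ x).norm.pow 2).aestronglyMeasurable ?_
  refine (ae_restrict_mem measurableSet_Icc).mono fun t ht => ?_
  rw [norm_pow, norm_norm]
  exact pow_le_pow_left₀ (norm_nonneg _) (hC t ht.2) 2

theorem integral_norm_sq_stepSlope_le (h : IsDiscreteFlow K J E τ a) (hE : ∀ V, 0 ≤ E V)
    (hτ : 0 < τ) {T : ℝ} (hT : 0 ≤ T) :
    ∫ t in Ioo 0 T, ‖stepSlope τ (fun i => J (a i)) t‖ ^ 2 ≤ E (a 0) := by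
  have key := intervalIntegral.integral_le_sub_of_hasDeriv_right_of_le hT
    (g := fun t => -linearInterp τ (fun i => E (a i)) t)
    (g' := fun t => -stepSlope τ (fun i => E (a i)) t)
    ((continuousOn_linearInterp hτ (fun i => E (a i))).mono fun x hx => hx.1).neg
    (fun x hx => ((hasDerivWithinAt_linearInterp hτ (fun i => E (a i)) hx.1.le).mono
      Ioi_subset_Ici_self).neg)
    (integrableOn_norm_sq_stepSlope hτ T fun i => J (a i))
    (fun x _ => h.norm_sq_stepSlope_le hτ x)
  rw [intervalIntegral.integral_of_le hT, integral_Ioc_eq_integral_Ioo, linearInterp_zero] at key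
  have h1 : 0 ≤ linearInterp τ (fun i => E (a i)) T := energy_interp_nonneg hE hτ hT
  linarith

end IsDiscreteFlow

/-- The discrete flows with a common initial value converge, as the time step tends to `0`. -/
theorem exists_limit_of_isDiscreteFlow [CompleteSpace X] {a : ℝ → ℕ → H} {a₀ : H}
    (h : ∀ τ, 0 < τ → IsDiscreteFlow K J E τ (a τ)) (h0 : ∀ τ, a τ 0 = a₀) (hE : ∀ V, 0 ≤ E V) :
    ∃ u : ℝ → X,
      (∀ τ, 0 < τ → ∀ t, 0 ≤ t →
        ‖linearInterp τ (fun i => J (a τ i)) t - u t‖ ^ 2 ≤ 8 * τ * E a₀) ∧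
      ∀ s t, 0 ≤ s → s ≤ t → ‖u t - u s‖ ≤ (1 + E a₀) / 2 * √(t - s) := by
  -- The limit is defined along the reference steps `1/(k+1)`. Comparing an arbitrary step `τ` with
  -- these and letting `k → ∞` gives the error bound for all `τ`, with the same `u`.
  set U : ℕ → ℝ → X := fun k t =>
    linearInterp (1 / ((k : ℝ) + 1)) (fun i => J (a (1 / ((k : ℝ) + 1)) i)) t with hU
  have hpos : ∀ k : ℕ, 0 < 1 / ((k : ℝ) + 1) := fun k => Nat.one_div_pos_of_nat
  have hdist : ∀ τ, 0 < τ → ∀ k : ℕ, ∀ t, 0 ≤ t →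
      ‖linearInterp τ (fun i => J (a τ i)) t - U k t‖ ^ 2
        ≤ 8 * (τ + 1 / ((k : ℝ) + 1)) * E a₀ := fun τ hτ k t ht => by
    have := (h τ hτ).norm_sq_linearInterp_sub_le (h _ (hpos k)) hE hτ (hpos k)
      ((h0 _).trans (h0 _).symm) ht
    rwa [h0] at this
  have hlim0 : Tendsto (fun k : ℕ => 1 / ((k : ℝ) + 1)) atTop (𝓝 0) :=
    tendsto_one_div_add_atTop_nhds_zero_nat
  have hlim : ∀ t, 0 ≤ t → ∃ x, Tendsto (fun k => U k t) atTop (𝓝 x) := by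
    intro t ht
    refine cauchySeq_tendsto_of_complete ?_
    refine cauchySeq_of_le_tendsto_0 (fun k : ℕ => √(16 * E a₀ * (1 / ((k : ℝ) + 1)))) ?_ ?_
    · intro n m k hn hm
      rw [dist_eq_norm]
      refine Real.le_sqrt_of_sq_le ((hdist _ (hpos n) m t ht).trans ?_)
      have h1 : 1 / ((n : ℝ) + 1) ≤ 1 / ((k : ℝ) + 1) := Nat.one_div_le_one_div hn
      have h2 : 1 / ((m : ℝ) + 1) ≤ 1 / ((k : ℝ) + 1) := Nat.one_div_le_one_div hm
      nlinarith [mul_le_mul_of_nonneg_right (add_le_add h1 h2) (hE a₀)]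
    · simpa using (hlim0.const_mul (16 * E a₀)).sqrt
  choose! u hu using hlim
  refine ⟨u, fun τ hτ t ht => ?_, fun s t hs hst => ?_⟩
  · have h1 : Tendsto (fun k : ℕ => 8 * (τ + 1 / ((k : ℝ) + 1)) * E a₀) atTop
        (𝓝 (8 * (τ + 0) * E a₀)) := ((hlim0.const_add τ).const_mul 8).mul_const _
    rw [add_zero] at h1
    exact le_of_tendsto_of_tendsto' ((tendsto_const_nhds.sub (hu t ht)).norm.pow 2) h1
      fun k => hdist τ hτ k t ht
  · refine le_of_tendsto' ((hu t (hs.trans hst)).sub (hu s hs)).norm fun k => ?_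
    have := (h _ (hpos k)).norm_linearInterp_sub_le hE (hpos k) hs hst
    rwa [h0] at this

end DiscreteEvolution

/-! ### Vector-valued Lebesgue spaces -/

noncomputable section LebesgueSpaces

/-- Makes every condition "is a weak derivative" closed, whence the completeness of `H1Time` and
`H2`. -/
theorem continuous_integral_smul_Lp {α X : Type*} [MeasurableSpace α] {μ : Measure α}
    [NormedAddCommGroup X] [NormedSpace ℝ X] [CompleteSpace X] {η : α → ℝ} (hη : MemLp η 2 μ) :
    Continuous fun v : Lp X 2 μ => ∫ t, η t • v t ∂μ := by
  have h : (fun v : Lp X 2 μ => ∫ t, η t • v t ∂μ)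
      = fun v => (ContinuousLinearMap.lsmul ℝ ℝ).lpPairing μ 2 2 (hη.toLp η) v := by
    funext v
    rw [ContinuousLinearMap.lpPairing_eq_integral]
    refine integral_congr_ae ?_
    filter_upwards [hη.coeFn_toLp] with t ht
    rw [ht]
    rfl
  rw [h]
  exact ContinuousLinearMap.continuous _

theorem norm_sq_Lp_two {α X : Type*} [MeasurableSpace α] {μ : Measure α}
    [NormedAddCommGroup X] [InnerProductSpace ℝ X] (v : Lp X 2 μ) :
    ‖v‖ ^ 2 = ∫ t, ‖v t‖ ^ 2 ∂μ := by
  rw [← real_inner_self_eq_norm_sq, L2.inner_def]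
  simp_rw [real_inner_self_eq_norm_sq]

theorem memLp_timeMeasure_of_continuousOn {X : Type*} [NormedAddCommGroup X] {T : ℝ} {v : ℝ → X}
    (hv : ContinuousOn v (Icc 0 T)) (p : ℝ≥0∞) : MemLp v p (timeMeasure T) := by
  obtain ⟨C, hC⟩ := isCompact_Icc.exists_bound_of_continuousOn hv
  refine MemLp.of_bound ((hv.mono Ioo_subset_Icc_self).aestronglyMeasurable measurableSet_Ioo) C ?_
  exact (ae_restrict_mem measurableSet_Ioo).mono fun t ht => hC t (Ioo_subset_Icc_self ht)

theorem norm_Lp_timeMeasure_le {X : Type*} [NormedAddCommGroup X] {T C : ℝ} (hC : 0 ≤ C)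
    (v : Lp X 2 (timeMeasure T)) (h : ∀ᵐ t ∂(timeMeasure T), ‖v t‖ ≤ C) :
    ‖v‖ ≤ (timeMeasure T).real univ ^ (2 : ℝ≥0∞).toReal⁻¹ * C :=
  Lp.norm_le_of_ae_bound hC h

/-- Uniform convergence on `[0, T]` implies convergence in `L²(0, T; X)`. -/
theorem tendsto_Lp_timeMeasure {X : Type*} [NormedAddCommGroup X] {T : ℝ}
    {v : ℕ → Lp X 2 (timeMeasure T)} {v' : Lp X 2 (timeMeasure T)} {δ : ℕ → ℝ}
    (hδ : Tendsto δ atTop (𝓝 0)) (h : ∀ k, ∀ᵐ t ∂(timeMeasure T), ‖v k t - v' t‖ ≤ δ k)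
    (hδ0 : ∀ k, 0 ≤ δ k) : Tendsto v atTop (𝓝 v') := by
  rw [tendsto_iff_norm_sub_tendsto_zero]
  refine squeeze_zero (fun k => norm_nonneg _) (fun k => norm_Lp_timeMeasure_le (hδ0 k) _ ?_)
    (by simpa using hδ.const_mul _)
  filter_upwards [h k, Lp.coeFn_sub (v k) v'] with t h1 h2
  rwa [h2]

end LebesgueSpaces

/-! ### The space `H¹(0, T; X)` -/

noncomputable section TimeSobolev

variable {X : Type*} [NormedAddCommGroup X] [InnerProductSpace ℝ X] [CompleteSpace X] {T : ℝ}

instance completeSpace_H1Time : CompleteSpace (H1Time T X) := by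
  suffices hcl : IsClosed
      (H1Time T X : Set (WithLp 2 (Lp X 2 (timeMeasure T) × Lp X 2 (timeMeasure T)))) from
    hcl.completeSpace_coe
  have h : (H1Time T X : Set (WithLp 2 (Lp X 2 (timeMeasure T) × Lp X 2 (timeMeasure T))))
      = ⋂ (η : ℝ → ℝ) (_ : ContDiff ℝ ∞ η) (_ : HasCompactSupport η) (_ : tsupport η ⊆ Ioo 0 T),
        {P | ∫ t in Ioo 0 T, deriv η t • P.fst t = - ∫ t in Ioo 0 T, η t • P.snd t} := by
    ext P
    simp only [mem_iInter]
    rfl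
  rw [h]
  refine isClosed_iInter fun η => isClosed_iInter fun hη => isClosed_iInter fun hc =>
    isClosed_iInter fun _ => ?_
  have hd : Continuous (deriv η) := hη.continuous_deriv (by simp)
  refine isClosed_eq ?_ ?_
  · exact (continuous_integral_smul_Lp (hd.memLp_of_hasCompactSupport hc.deriv)).comp
      (WithLp.prod_continuous_ofLp 2 _ _).fst
  · exact ((continuous_integral_smul_Lp (hη.continuous.memLp_of_hasCompactSupport hc)).comp
      (WithLp.prod_continuous_ofLp 2 _ _).snd).neg

/-- The embedding of `H¹(0, T; X)` in `L²(0, T; X)`. -/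
def H1Time.toLp (T : ℝ) (X : Type*) [NormedAddCommGroup X] [InnerProductSpace ℝ X] :
    H1Time T X →L[ℝ] Lp X 2 (timeMeasure T) :=
  (WithLp.fstL 2 ℝ _ _).comp (H1Time T X).subtypeL

/-- The time derivative as a bounded operator. -/
def H1Time.derivL (T : ℝ) (X : Type*) [NormedAddCommGroup X] [InnerProductSpace ℝ X] :
    H1Time T X →L[ℝ] Lp X 2 (timeMeasure T) :=
  (WithLp.sndL 2 ℝ _ _).comp (H1Time T X).subtypeL

/-- A function determines its weak derivative, by the fundamental lemma of the calculus of
variations. Injectivity is what the criterion for weak convergence requires. -/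
theorem H1Time.toLp_injective : Function.Injective (H1Time.toLp T X) := by
  rw [injective_iff_map_eq_zero]
  rintro ⟨P, hP⟩ h
  have h1 : P.fst = 0 := h
  have h2 : P.snd = 0 := by
    rw [Lp.eq_zero_iff_ae_eq_zero, EventuallyEq, ae_restrict_iff' measurableSet_Ioo]
    refine isOpen_Ioo.ae_eq_zero_of_integral_contDiff_smul_eq_zero ?_ fun η hη hc hs => ?_
    · exact IntegrableOn.locallyIntegrableOn ((Lp.memLp P.snd).integrable (by norm_num))
    · have h3 := hP η hη hc hs
      rw [h1] at h3
      have h4 : ∫ t in Ioo 0 T, deriv η t • (0 : Lp X 2 (timeMeasure T)) t = 0 :=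
        integral_eq_zero_of_ae (by
          filter_upwards [Lp.coeFn_zero X 2 (timeMeasure T)] with t ht
          rw [ht]; exact smul_zero _)
      rw [h4, zero_eq_neg] at h3
      rw [← h3]
      refine (setIntegral_eq_integral_of_forall_compl_eq_zero fun t ht => ?_).symm
      rw [image_eq_zero_of_notMem_tsupport fun h => ht (hs h), zero_smul]
  apply Subtype.ext
  apply (WithLp.equiv 2 _).injective
  exact Prod.ext h1 h2

omit [CompleteSpace X] in
theorem H1Time.norm_le {P : H1Time T X} {A B : ℝ} (h1 : ‖P.1.fst‖ ≤ A) (h2 : ‖P.1.snd‖ ≤ B) :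
    ‖P‖ ≤ A + B := by
  have h := WithLp.prod_norm_sq_eq_of_L2 P.1
  have : ‖P‖ = ‖P.1‖ := rfl
  rw [this]
  nlinarith [norm_nonneg P.1, norm_nonneg P.1.fst, norm_nonneg P.1.snd]

/-- Integration by parts is the fundamental theorem of calculus for `η v`, in its version for right
derivatives; the boundary terms vanish with `η`. -/
theorem exists_H1Time_linearInterp {τ : ℝ} (hτ : 0 < τ) (hT : 0 ≤ T) (x : ℕ → X) :
    ∃ P : H1Time T X, IsClassOfH1Time P (linearInterp τ x) ∧
      timeDeriv P =ᵐ[timeMeasure T] stepSlope τ x := by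
  have hcont : ContinuousOn (linearInterp τ x) (Icc 0 T) :=
    (continuousOn_linearInterp hτ x).mono fun t ht => ht.1
  have hv := memLp_timeMeasure_of_continuousOn hcont 2
  obtain ⟨C, hC⟩ := exists_norm_stepSlope_le hτ x T
  have hbound : ∀ᵐ t ∂(timeMeasure T), ‖stepSlope τ x t‖ ≤ C :=
    (ae_restrict_mem measurableSet_Ioo).mono fun t ht => hC t ht.2.le
  have hw : MemLp (stepSlope τ x) 2 (timeMeasure T) :=
    MemLp.of_bound (stronglyMeasurable_stepSlope τ x).aestronglyMeasurable C hbound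
  refine ⟨⟨WithLp.toLp 2 (hv.toLp _, hw.toLp _), fun η hη hc hs => ?_⟩, hv.coeFn_toLp,
    hw.coeFn_toLp⟩
  have hd : Continuous (deriv η) := hη.continuous_deriv (by simp)
  have i1 : Integrable (fun t => deriv η t • linearInterp τ x t) (timeMeasure T) :=
    memLp_one_iff_integrable.1 (hv.smul (p := 2) (r := 1) (hd.memLp_of_hasCompactSupport hc.deriv))
  have i2 : Integrable (fun t => η t • stepSlope τ x t) (timeMeasure T) :=
    memLp_one_iff_integrable.1
      (hw.smul (p := 2) (r := 1) (hη.continuous.memLp_of_hasCompactSupport hc))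
  have e1 : ∫ t in Ioo 0 T, deriv η t • (hv.toLp _) t
      = ∫ t in Ioo 0 T, deriv η t • linearInterp τ x t :=
    integral_congr_ae (by filter_upwards [hv.coeFn_toLp] with t ht; rw [ht])
  have e2 : ∫ t in Ioo 0 T, η t • (hw.toLp _) t = ∫ t in Ioo 0 T, η t • stepSlope τ x t :=
    integral_congr_ae (by filter_upwards [hw.coeFn_toLp] with t ht; rw [ht])
  change ∫ t in Ioo 0 T, deriv η t • (hv.toLp _) t = - ∫ t in Ioo 0 T, η t • (hw.toLp _) t
  rw [e1, e2, eq_neg_iff_add_eq_zero, ← integral_add i1 i2, ← integral_Ioc_eq_integral_Ioo,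
    ← intervalIntegral.integral_of_le hT]
  have h0 : ∀ t, t ∉ Ioo 0 T → η t = 0 := fun t ht =>
    image_eq_zero_of_notMem_tsupport fun h => ht (hs h)
  rw [intervalIntegral.integral_eq_sub_of_hasDeriv_right_of_le hT
    (f := fun t => η t • linearInterp τ x t)]
  · simp [h0]
  · exact hη.continuous.continuousOn.smul hcont
  · intro t ht
    have := (hη.differentiable (by simp) t).hasDerivAt.hasDerivWithinAt (s := Ioi t) |>.smul
      ((hasDerivWithinAt_linearInterp hτ x ht.1.le).mono Ioi_subset_Ici_self)
    rwa [add_comm] at this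
  · rw [intervalIntegrable_iff_integrableOn_Ioc_of_le hT, integrableOn_Ioc_iff_integrableOn_Ioo]
    exact i1.add i2

end TimeSobolev

/-! ### Weak convergence to the limit flow -/

noncomputable section FlowLimit

variable {H X : Type*} [NormedAddCommGroup H] [InnerProductSpace ℝ H]
  [NormedAddCommGroup X] [InnerProductSpace ℝ X]

/-- A family of discrete flows with common initial value `a₀`, together with their limit `u` as the
time step tends to `0`, for a coercive convex energy on a closed convex set. -/
structure IsFlowLimit (K : Set H) (J : H →L[ℝ] X) (E : H → ℝ) (a : ℝ → ℕ → H) (a₀ : H)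
    (u : ℝ → X) (C : ℝ) : Prop where
  isClosed : IsClosed K
  convex : Convex ℝ K
  injective : Function.Injective J
  nonneg : ∀ V, 0 ≤ E V
  convexOn : ConvexOn ℝ K E
  coercive : ∀ V ∈ K, ‖V‖ ^ 2 ≤ C * (E V + ‖J V‖ ^ 2)
  const_nonneg : 0 ≤ C
  flow : ∀ τ, 0 < τ → IsDiscreteFlow K J E τ (a τ)
  init : ∀ τ, a τ 0 = a₀
  dist_le : ∀ τ, 0 < τ → ∀ t, 0 ≤ t →
    ‖linearInterp τ (fun i => J (a τ i)) t - u t‖ ^ 2 ≤ 8 * τ * E a₀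
  modulus : ∀ s t, 0 ≤ s → s ≤ t → ‖u t - u s‖ ≤ (1 + E a₀) / 2 * √(t - s)

/-- The time step `T / (k + 1)`. -/
def meshSize (T : ℝ) (k : ℕ) : ℝ := T / (k + 1 : ℕ)

theorem meshSize_pos {T : ℝ} (hT : 0 < T) (k : ℕ) : 0 < meshSize T k := by
  unfold meshSize; positivity

theorem tendsto_meshSize (T : ℝ) : Tendsto (meshSize T) atTop (𝓝 0) := by
  have h := (tendsto_one_div_add_atTop_nhds_zero_nat (𝕜 := ℝ)).const_mul T
  rw [mul_zero] at h
  refine h.congr fun k => ?_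
  simp [meshSize, div_eq_mul_inv]

namespace IsFlowLimit

variable {K : Set H} {J : H →L[ℝ] X} {E : H → ℝ} {a : ℝ → ℕ → H} {a₀ : H} {u : ℝ → X} {C : ℝ}

theorem interp_mem (h : IsFlowLimit K J E a a₀ u C) {τ t : ℝ} (hτ : 0 < τ) (ht : 0 ≤ t) :
    linearInterp τ (a τ) t ∈ K ∧ E (linearInterp τ (a τ) t) ≤ E a₀ := by
  refine linearInterp_mem_of_convex hτ ht (h.convexOn.convex_le (E a₀)) fun i =>
    ⟨(h.flow τ hτ).mem i, ?_⟩
  have := (h.flow τ hτ).energy_le hτ i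
  rwa [h.init] at this

theorem map_interp (τ t : ℝ) :
    J (linearInterp τ (a τ) t) = linearInterp τ (fun i => J (a τ i)) t :=
  map_linearInterp (J : H →ₗ[ℝ] X) τ (a τ) t

theorem norm_map_interp_le (h : IsFlowLimit K J E a a₀ u C) {τ t T : ℝ} (hτ : 0 < τ)
    (ht : 0 ≤ t) (htT : t ≤ T) :
    ‖linearInterp τ (fun i => J (a τ i)) t‖ ≤ ‖J a₀‖ + (1 + E a₀) / 2 * √T := by
  have h1 := (h.flow τ hτ).norm_linearInterp_sub_le h.nonneg hτ le_rfl ht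
  rw [linearInterp_zero, h.init, sub_zero] at h1
  have h2 : √t ≤ √T := Real.sqrt_le_sqrt htT
  have h3 := h.nonneg a₀
  have h4 : (1 + E a₀) / 2 * √t ≤ (1 + E a₀) / 2 * √T := by gcongr
  linarith [norm_le_insert' (linearInterp τ (fun i => J (a τ i)) t) (J a₀)]

/-- Convexity passes the energy bound from the nodes to the interpolant, and coercivity turns it
into a bound in `H`. -/
theorem exists_norm_interp_le (h : IsFlowLimit K J E a a₀ u C) (T : ℝ) :
    ∃ M, 0 ≤ M ∧ ∀ τ t, 0 < τ → 0 ≤ t → t ≤ T → ‖linearInterp τ (a τ) t‖ ≤ M := by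
  refine ⟨√(C * (E a₀ + (‖J a₀‖ + (1 + E a₀) / 2 * √T) ^ 2)), Real.sqrt_nonneg _,
    fun τ t hτ ht htT => Real.le_sqrt_of_sq_le ?_⟩
  obtain ⟨h1, h2⟩ := h.interp_mem hτ ht
  refine (h.coercive _ h1).trans (mul_le_mul_of_nonneg_left (add_le_add h2 ?_) h.const_nonneg)
  rw [map_interp]
  exact pow_le_pow_left₀ (norm_nonneg _) (h.norm_map_interp_le hτ ht htT) 2

theorem dist_meshSize_le (h : IsFlowLimit K J E a a₀ u C) {T : ℝ} (hT : 0 < T) (k : ℕ) {t : ℝ}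
    (ht : 0 ≤ t) : ‖linearInterp (meshSize T k) (fun i => J (a (meshSize T k) i)) t - u t‖
      ≤ √(8 * meshSize T k * E a₀) :=
  Real.le_sqrt_of_sq_le (h.dist_le _ (meshSize_pos hT k) t ht)

theorem tendsto_sqrt_meshSize (T c : ℝ) :
    Tendsto (fun k => √(8 * meshSize T k * c)) atTop (𝓝 0) := by
  simpa using (((tendsto_meshSize T).const_mul 8).mul_const c).sqrt

theorem continuousOn_limit (h : IsFlowLimit K J E a a₀ u C) {T : ℝ} (hT : 0 < T) :
    ContinuousOn u (Icc 0 T) := by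
  refine TendstoUniformlyOn.continuousOn
    (F := fun k => linearInterp (meshSize T k) (fun i => J (a (meshSize T k) i))) (p := atTop) ?_
    (Frequently.of_forall fun k =>
      (continuousOn_linearInterp (meshSize_pos hT k) _).mono fun t ht => ht.1)
  rw [Metric.tendstoUniformlyOn_iff]
  intro ε hε
  filter_upwards [(tendsto_sqrt_meshSize T (E a₀)).eventually_lt_const hε] with k hk t ht
  rw [dist_comm, dist_eq_norm]
  exact (h.dist_meshSize_le hT k ht.1).trans_lt hk

/-- The weak limit in `H` is taken at a fixed time, so the constraint holds at every `t` and not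
merely at almost every one. -/
theorem exists_mem_of_nonneg [CompleteSpace H] [CompleteSpace X]
    (h : IsFlowLimit K J E a a₀ u C) {T M : ℝ} (hT : 0 < T)
    (hM : ∀ τ t, 0 < τ → 0 ≤ t → t ≤ T → ‖linearInterp τ (a τ) t‖ ≤ M)
    {t : ℝ} (ht : 0 ≤ t) (htT : t ≤ T) : ∃ V ∈ K, J V = u t ∧ ‖V‖ ≤ M := by
  have hlim : Tendsto (fun k => J (linearInterp (meshSize T k) (a (meshSize T k)) t)) atTop
      (𝓝 (u t)) := by
    rw [tendsto_iff_norm_sub_tendsto_zero]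
    refine squeeze_zero (fun _ => norm_nonneg _) (fun k => ?_) (tendsto_sqrt_meshSize T (E a₀))
    rw [map_interp]
    exact h.dist_meshSize_le hT k ht
  have hb := fun k => hM _ t (meshSize_pos hT k) ht htT
  obtain ⟨V, hV, hw⟩ := exists_weaklyTendsto_of_injective J h.injective hb hlim
  exact ⟨V, hw.mem_of_isClosed_convex h.isClosed h.convex fun k =>
    (h.interp_mem (meshSize_pos hT k) ht).1, hV,
    hw.norm_map_le (ContinuousLinearMap.id ℝ H) hb⟩

theorem compLpL_injective {α : Type*} [MeasurableSpace α] {μ : Measure α} {J : H →L[ℝ] X}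
    (hJ : Function.Injective J) : Function.Injective (J.compLpL 2 μ) := by
  rw [injective_iff_map_eq_zero]
  intro f hf
  rw [Lp.eq_zero_iff_ae_eq_zero] at hf ⊢
  filter_upwards [hf, J.coeFn_compLpL f] with t h1 h2
  rw [h1] at h2
  exact hJ (by simpa using h2.symm)

/-- Weak convergence in `L²(0, T; H)` of the interpolants. -/
theorem exists_weaklyTendsto_Lp [CompleteSpace H] [CompleteSpace X]
    (h : IsFlowLimit K J E a a₀ u C) {T : ℝ} (hT : 0 < T) :
    ∃ (Q : ℕ → Lp H 2 (timeMeasure T)) (Q' : Lp H 2 (timeMeasure T)) (M : ℝ),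
      (∀ k, ∀ᵐ t ∂(timeMeasure T),
        J (Q k t) = linearInterp (meshSize T k) (fun i => J (a (meshSize T k) i)) t) ∧
      (∀ᵐ t ∂(timeMeasure T), Q' t ∈ K ∧ J (Q' t) = u t ∧ ‖Q' t‖ ≤ M) ∧
      WeaklyTendsto Q Q' := by
  obtain ⟨M, hM0, hM⟩ := h.exists_norm_interp_le T
  have hmem := fun k => memLp_timeMeasure_of_continuousOn (T := T)
    ((continuousOn_linearInterp (meshSize_pos hT k) (a (meshSize T k))).mono fun t ht => ht.1) 2
  have hu := memLp_timeMeasure_of_continuousOn (h.continuousOn_limit hT) 2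
  have hIoo : ∀ᵐ t ∂(timeMeasure T), t ∈ Ioo 0 T := ae_restrict_mem measurableSet_Ioo
  set Q : ℕ → Lp H 2 (timeMeasure T) := fun k => (hmem k).toLp _ with hQ
  have hJQ : ∀ k, ∀ᵐ t ∂(timeMeasure T),
      J (Q k t) = linearInterp (meshSize T k) (fun i => J (a (meshSize T k) i)) t := fun k => by
    filter_upwards [(hmem k).coeFn_toLp] with t ht
    rw [ht, map_interp]
  have hb : ∀ k, ‖Q k‖ ≤ (timeMeasure T).real univ ^ (2 : ℝ≥0∞).toReal⁻¹ * M := fun k => by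
    refine norm_Lp_timeMeasure_le hM0 _ ?_
    filter_upwards [(hmem k).coeFn_toLp, hIoo] with t ht htI
    rw [ht]
    exact hM _ t (meshSize_pos hT k) htI.1.le htI.2.le
  have hlim : Tendsto (fun k => J.compLpL 2 (timeMeasure T) (Q k)) atTop (𝓝 (hu.toLp u)) := by
    refine tendsto_Lp_timeMeasure (tendsto_sqrt_meshSize T (E a₀)) (fun k => ?_)
      fun k => Real.sqrt_nonneg _
    filter_upwards [J.coeFn_compLpL (Q k), hJQ k, hu.coeFn_toLp, hIoo] with t h1 h2 h3 h4
    rw [h1, h2, h3]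
    exact h.dist_meshSize_le hT k h4.1.le
  obtain ⟨Q', hQ', hw⟩ :=
    exists_weaklyTendsto_of_injective _ (compLpL_injective h.injective) hb hlim
  refine ⟨Q, Q', M, hJQ, ?_, hw⟩
  filter_upwards [J.coeFn_compLpL Q', hu.coeFn_toLp, hIoo] with t h1 h2 h3
  rw [hQ', h2] at h1
  -- Since `J` is injective, `Q' t` is the weak limit at the fixed time `t`, and inherits the
  -- constraint and the bound from it.
  obtain ⟨V, hVK, hV, hVM⟩ := h.exists_mem_of_nonneg hT hM h3.1.le h3.2.le
  have : Q' t = V := h.injective (h1.symm.trans hV.symm)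
  rw [this]
  exact ⟨hVK, hV, hVM⟩

theorem exists_H1Time_interp (h : IsFlowLimit K J E a a₀ u C) [CompleteSpace X] {T : ℝ}
    (hT : 0 < T) (k : ℕ) :
    ∃ P : H1Time T X, IsClassOfH1Time P
        (linearInterp (meshSize T k) (fun i => J (a (meshSize T k) i))) ∧
      ‖timeDeriv P‖ ≤ √(E a₀) ∧ ‖P.1.fst‖ ≤ (timeMeasure T).real univ ^ (2 : ℝ≥0∞).toReal⁻¹ *
      (‖J a₀‖ + (1 + E a₀) / 2 * √T) := by
  have hE := h.nonneg a₀
  obtain ⟨P, hP, hP'⟩ := exists_H1Time_linearInterp (meshSize_pos hT k) hT.le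
    (fun i => J (a (meshSize T k) i))
  refine ⟨P, hP, Real.le_sqrt_of_sq_le ?_, norm_Lp_timeMeasure_le (by positivity) _ ?_⟩
  · rw [norm_sq_Lp_two]
    have h1 := (h.flow _ (meshSize_pos hT k)).integral_norm_sq_stepSlope_le h.nonneg
      (meshSize_pos hT k) hT.le
    rw [h.init] at h1
    refine le_trans (le_of_eq (integral_congr_ae ?_)) h1
    filter_upwards [hP'] with t ht
    rw [ht]
  · filter_upwards [hP, ae_restrict_mem measurableSet_Ioo] with t ht htI
    rw [ht]
    exact h.norm_map_interp_le (meshSize_pos hT k) htI.1.le htI.2.le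

/-- Weak convergence in `H¹(0, T; X)` of the interpolants. -/
theorem exists_weaklyTendsto_H1Time [CompleteSpace X] (h : IsFlowLimit K J E a a₀ u C) {T : ℝ}
    (hT : 0 < T) :
    ∃ (P : ℕ → H1Time T X) (P' : H1Time T X),
      (∀ k, IsClassOfH1Time (P k)
        (linearInterp (meshSize T k) (fun i => J (a (meshSize T k) i)))) ∧
      IsClassOfH1Time P' u ∧ ‖timeDeriv P'‖ ^ 2 ≤ E a₀ ∧ WeaklyTendsto P P' := by
  have hu := memLp_timeMeasure_of_continuousOn (h.continuousOn_limit hT) 2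
  choose P hP hd hv using h.exists_H1Time_interp hT
  have hlim : Tendsto (fun k => H1Time.toLp T X (P k)) atTop (𝓝 (hu.toLp u)) := by
    refine tendsto_Lp_timeMeasure (tendsto_sqrt_meshSize T (E a₀)) (fun k => ?_)
      fun k => Real.sqrt_nonneg _
    filter_upwards [hP k, hu.coeFn_toLp, ae_restrict_mem measurableSet_Ioo] with t h1 h3 h4
    have h5 : H1Time.toLp T X (P k) t = (P k).1.fst t := rfl
    rw [h5, h1, h3]
    exact h.dist_meshSize_le hT k h4.1.le
  obtain ⟨P', hP'', hw⟩ := exists_weaklyTendsto_of_injective (H1Time.toLp T X)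
    H1Time.toLp_injective (fun k => H1Time.norm_le (hv k) (hd k)) hlim
  refine ⟨P, P', hP, ?_, ?_, hw⟩
  · have : P'.1.fst = hu.toLp u := hP''
    rw [IsClassOfH1Time, this]
    exact hu.coeFn_toLp
  · have h1 : ‖H1Time.derivL T X P'‖ ≤ √(E a₀) := hw.norm_map_le (H1Time.derivL T X) hd
    have h2 : H1Time.derivL T X P' = timeDeriv P' := rfl
    rw [h2] at h1
    exact (Real.le_sqrt (norm_nonneg _) (h.nonneg a₀)).1 h1

end IsFlowLimit

end FlowLimit

/-! ### Interpolation of Hölder norms -/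

noncomputable section HolderBounds

variable {X : Type*} [NormedAddCommGroup X] {T : ℝ} {α : ℝ≥0}

/-- A sup bound `δ` is a Hölder bound of exponent `0` with constant `2δ`. Interpolating with
exponent `1/2`, with weights `1 - 2α` and `2α`, leaves a positive power of `δ`. -/
theorem holderNormOn_le_of_half (hα : α < 1 / 2) {w : ℝ → X} {δ C : ℝ≥0}
    (hδ : ∀ t ∈ Icc 0 T, ‖w t‖ ≤ δ)
    (hC : ∀ s t, 0 ≤ s → s ≤ t → t ≤ T → ‖w t - w s‖ ≤ C * √(t - s)) :
    holderNormOn T α w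
      ≤ ((δ + (2 * δ) ^ (1 - 2 * (α : ℝ)) * C ^ (2 * (α : ℝ)) : ℝ≥0) : ℝ≥0∞) := by
  have hα' : 2 * α < 1 := by
    rw [← NNReal.coe_lt_coe] at hα ⊢
    push_cast at hα ⊢
    linarith
  have h0 : HolderWith (2 * δ) 0 (fun t : Icc (0 : ℝ) T => w t) := fun x y => by
    simp only [NNReal.coe_zero, ENNReal.rpow_zero, mul_one]
    rw [edist_nndist, ENNReal.coe_le_coe, ← NNReal.coe_le_coe, coe_nndist, dist_eq_norm]
    push_cast
    linarith [norm_sub_le (w x) (w y), hδ x x.2, hδ y y.2]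
  have hsymm : ∀ x y : Icc (0 : ℝ) T, ‖w x - w y‖ ≤ C * √|(x : ℝ) - y| := fun x y => by
    rcases le_total (y : ℝ) x with h | h
    · rw [abs_of_nonneg (sub_nonneg.2 h)]
      exact hC _ _ y.2.1 h x.2.2
    · rw [abs_sub_comm, abs_of_nonneg (sub_nonneg.2 h), norm_sub_rev]
      exact hC _ _ x.2.1 h y.2.2
  have h1 : HolderWith C (1 / 2) (fun t : Icc (0 : ℝ) T => w t) := fun x y => by
    rw [edist_nndist, edist_nndist, ← ENNReal.coe_rpow_of_nonneg _ (NNReal.coe_nonneg _),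
      ← ENNReal.coe_mul, ENNReal.coe_le_coe, ← NNReal.coe_le_coe, coe_nndist, dist_eq_norm]
    push_cast
    rw [← Real.sqrt_eq_rpow]
    exact hsymm x y
  have h2 := h0.interpolate h1 (t₁ := 1 - 2 * α) (t₂ := 2 * α) (tsub_add_cancel_of_le hα'.le)
  have e1 : (0 : ℝ≥0) * (1 - 2 * α) + 1 / 2 * (2 * α) = α := by
    rw [zero_mul, zero_add, ← mul_assoc]; norm_num
  rw [e1] at h2
  rw [holderNormOn, ENNReal.coe_add]
  refine add_le_add (iSup_le fun t => ?_) ?_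
  · rw [enorm_eq_nnnorm, ENNReal.coe_le_coe]
    exact hδ t t.2
  · have h3 := h2.eHolderNorm_le
    rwa [NNReal.coe_sub hα'.le, NNReal.coe_mul] at h3

theorem tendsto_holderNormOn_zero (hα : α < 1 / 2) {w : ℕ → ℝ → X} {δ : ℕ → ℝ≥0}
    {C : ℝ≥0} (hlim : Tendsto δ atTop (𝓝 0)) (hδ : ∀ k, ∀ t ∈ Icc 0 T, ‖w k t‖ ≤ δ k)
    (hC : ∀ k s t, 0 ≤ s → s ≤ t → t ≤ T → ‖w k t - w k s‖ ≤ C * √(t - s)) :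
    Tendsto (fun k => holderNormOn T α (w k)) atTop (𝓝 0) := by
  have hα' : 0 < 1 - 2 * (α : ℝ) := by
    have : (α : ℝ) < 1 / 2 := by exact_mod_cast hα
    linarith
  have h1 : Tendsto (fun k => δ k + (2 * δ k) ^ (1 - 2 * (α : ℝ)) * C ^ (2 * (α : ℝ))) atTop
      (𝓝 (0 + (2 * 0) ^ (1 - 2 * (α : ℝ)) * C ^ (2 * (α : ℝ)))) :=
    hlim.add (((hlim.const_mul 2).nnrpow tendsto_const_nhds (Or.inr hα')).mul_const _)
  rw [mul_zero, NNReal.zero_rpow hα'.ne', zero_mul, add_zero] at h1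
  refine tendsto_of_tendsto_of_tendsto_of_le_of_le tendsto_const_nhds (ENNReal.tendsto_coe.2 h1)
    (fun k => bot_le) fun k => holderNormOn_le_of_half hα (hδ k) (hC k)

end HolderBounds

/-! ### Hölder convergence of the flow -/

noncomputable section FlowHolder

variable {H X : Type*} [NormedAddCommGroup H] [InnerProductSpace ℝ H]
  [NormedAddCommGroup X] [InnerProductSpace ℝ X]
variable {K : Set H} {J : H →L[ℝ] X} {E : H → ℝ} {a : ℝ → ℕ → H} {a₀ : H} {u : ℝ → X} {C : ℝ}

theorem IsFlowLimit.holderNormOn_lt_top (h : IsFlowLimit K J E a a₀ u C) {T : ℝ} (hT : 0 < T)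
    {α : ℝ≥0} (hα : α < 1 / 2) : holderNormOn T α u < ⊤ := by
  obtain ⟨M, hM⟩ := isCompact_Icc.exists_bound_of_continuousOn (h.continuousOn_limit hT)
  have hE := h.nonneg a₀
  refine (holderNormOn_le_of_half hα (δ := M.toNNReal) (C := ((1 + E a₀) / 2).toNNReal)
    (fun t ht => (hM t ht).trans (Real.le_coe_toNNReal M)) fun s t hs hst _ => ?_).trans_lt
    ENNReal.coe_lt_top
  rw [Real.coe_toNNReal _ (by positivity)]
  exact h.modulus s t hs hst

theorem IsFlowLimit.tendsto_holderNormOn (h : IsFlowLimit K J E a a₀ u C) {T : ℝ} (hT : 0 < T)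
    {α : ℝ≥0} (hα : α < 1 / 2) :
    Tendsto (fun k => holderNormOn T α fun t =>
      linearInterp (meshSize T k) (fun i => J (a (meshSize T k) i)) t - u t) atTop (𝓝 0) := by
  have hE := h.nonneg a₀
  -- `1 + E a₀` is the sum of the two constants `(1 + E a₀)/2`, of the interpolant and of the limit.
  refine tendsto_holderNormOn_zero hα (δ := fun k => (√(8 * meshSize T k * E a₀)).toNNReal)
    (C := (1 + E a₀).toNNReal) ?_ (fun k t ht => ?_) fun k s t hs hst _ => ?_
  · simpa using tendsto_real_toNNReal (tendsto_sqrt_meshSize T (E a₀))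
  · exact (h.dist_meshSize_le hT k ht.1).trans (Real.le_coe_toNNReal _)
  · rw [Real.coe_toNNReal _ (by positivity)]
    have h1 := (h.flow _ (meshSize_pos hT k)).norm_linearInterp_sub_le h.nonneg
      (meshSize_pos hT k) hs hst
    rw [h.init] at h1
    have h2 := h.modulus s t hs hst
    rw [sub_sub_sub_comm]
    refine (norm_sub_le _ _).trans ?_
    linarith

end FlowHolder

/-! ### Test functions and weak derivatives -/

noncomputable section TestFunctions

variable {N : ℕ} {Ω : Set (Euc N)}

/-- The partial derivative `∂ᵢ φ`. -/
def partialDeriv (i : Fin N) (φ : Euc N → ℝ) : Euc N → ℝ := fun x => fderiv ℝ φ x (stdVec i)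

namespace IsTest

variable {φ ψ : Euc N → ℝ}

theorem pderiv (h : IsTest Ω φ) (i : Fin N) : IsTest Ω (partialDeriv i φ) where
  smooth := (h.smooth.fderiv_right (m := ∞) (by simp)).clm_apply contDiff_const
  compact := h.compact.fderiv_apply ℝ _
  support := (tsupport_fderiv_apply_subset ℝ _).trans h.support

theorem zero : IsTest Ω (0 : Euc N → ℝ) where
  smooth := contDiff_const
  compact := HasCompactSupport.zero
  support := by simp [tsupport]

theorem add (h : IsTest Ω φ) (h' : IsTest Ω ψ) : IsTest Ω (φ + ψ) where
  smooth := h.smooth.add h'.smooth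
  compact := h.compact.add h'.compact
  support := (tsupport_add φ ψ).trans (union_subset h.support h'.support)

theorem smul (c : ℝ) (h : IsTest Ω φ) : IsTest Ω (c • φ) where
  smooth := h.smooth.const_smul c
  compact := h.compact.smul_left (f := fun _ => c)
  support := (tsupport_smul_subset_right (fun _ => c) φ).trans h.support

theorem continuous (h : IsTest Ω φ) : Continuous φ := h.smooth.continuous

theorem memLp (h : IsTest Ω φ) (p : ℝ≥0∞) (μ : Measure (Euc N)) [IsFiniteMeasureOnCompacts μ] :
    MemLp φ p μ := h.continuous.memLp_of_hasCompactSupport h.compact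

theorem eq_zero (h : IsTest Ω φ) {x : Euc N} (hx : x ∉ Ω) : φ x = 0 :=
  image_eq_zero_of_notMem_tsupport fun h' => hx (h.support h')

theorem integrable_mul' (h : IsTest Ω φ) (h' : IsTest Ω ψ) : Integrable fun x => φ x * ψ x :=
  (h.memLp 2 volume).integrable_mul (q := 2) (h'.memLp 2 volume)

theorem integral_mul_partialDeriv (h : IsTest Ω φ) (h' : IsTest Ω ψ) (i : Fin N) :
    ∫ x, φ x * partialDeriv i ψ x
      = - ∫ x, partialDeriv i φ x * ψ x :=
  integral_mul_fderiv_eq_neg_fderiv_mul_of_integrable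
    ((h.pderiv i).integrable_mul' h') (h.integrable_mul' (h'.pderiv i))
    (h.integrable_mul' h') (fun x _ => h.smooth.differentiable (by simp) x)
    (fun x _ => h'.smooth.differentiable (by simp) x)

theorem partialDeriv_comm (h : IsTest Ω φ) (i j : Fin N) :
    partialDeriv i (partialDeriv j φ)
      = partialDeriv j (partialDeriv i φ) := by
  have hd : Differentiable ℝ (fderiv ℝ φ) :=
    (h.smooth.fderiv_right (m := ∞) (by simp)).differentiable (by simp)
  have key : ∀ (k l : Fin N) (x : Euc N),
      partialDeriv k (partialDeriv l φ) x
        = fderiv ℝ (fderiv ℝ φ) x (stdVec k) (stdVec l) := fun k l x => by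
    change fderiv ℝ (fun y => fderiv ℝ φ y (stdVec l)) x (stdVec k) = _
    rw [fderiv_clm_apply (hd x) (differentiableAt_const _)]
    simp
  funext x
  rw [key, key]
  exact (h.smooth.contDiffAt.isSymmSndFDerivAt (by
    rw [minSmoothness_of_isRCLikeNormedField]
    exact WithTop.coe_le_coe.2 le_top)).eq _ _

/-- Two integrations by parts and the symmetry of mixed derivatives. Summed over `i`, `j`, this is
`∫|D²φ|² = ∫|Δφ|²`. -/
theorem integral_hessian_sq (h : IsTest Ω φ) (i j : Fin N) :
    ∫ x, partialDeriv j (partialDeriv i φ) x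
        * partialDeriv j (partialDeriv i φ) x
      = ∫ x, partialDeriv i (partialDeriv i φ) x
        * partialDeriv j (partialDeriv j φ) x := by
  have hi := h.pderiv i
  have hj := h.pderiv j
  rw [(hi.pderiv j).integral_mul_partialDeriv hi j, hi.partialDeriv_comm j j,
    h.partialDeriv_comm j i, hj.partialDeriv_comm j i,
    ← (hj.pderiv j).integral_mul_partialDeriv hi i]
  simp_rw [mul_comm]

theorem setIntegral_mul_eq (h : IsTest Ω φ) (χ : Euc N → ℝ) :
    ∫ x in Ω, χ x * φ x = ∫ x, χ x * φ x :=
  setIntegral_eq_integral_of_forall_compl_eq_zero fun x hx => by rw [h.eq_zero hx, mul_zero]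

theorem inner_eq (h' : IsTest Ω ψ) {v w : L2 Ω} (hv : v =ᵐ[volume.restrict Ω] φ)
    (hw : w =ᵐ[volume.restrict Ω] ψ) : inner ℝ v w = ∫ x, φ x * ψ x := by
  rw [L2.inner_def, ← h'.setIntegral_mul_eq]
  refine integral_congr_ae ?_
  filter_upwards [hv, hw] with x h1 h2
  rw [h1, h2]
  exact mul_comm _ _

end IsTest

theorem IsWeakPartial.unique (hΩ : IsOpen Ω) {i : Fin N} {v p q : L2 Ω}
    (hp : IsWeakPartial Ω i v p) (hq : IsWeakPartial Ω i v q) : p = q := by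
  rw [← sub_eq_zero, Lp.eq_zero_iff_ae_eq_zero, EventuallyEq,
    ae_restrict_iff' hΩ.measurableSet]
  refine hΩ.ae_eq_zero_of_integral_contDiff_smul_eq_zero ?_ fun η hη hc hs => ?_
  · exact locallyIntegrableOn_of_locallyIntegrable_restrict
      ((Lp.memLp (p - q)).locallyIntegrable (by norm_num))
  · have ht : IsTest Ω η := ⟨hη, hc, hs⟩
    simp_rw [smul_eq_mul, mul_comm (η _)]
    rw [← ht.setIntegral_mul_eq]
    have h1 : ∫ x in Ω, (p - q) x * η x = ∫ x in Ω, (p x * η x - q x * η x) :=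
      integral_congr_ae (by
        filter_upwards [Lp.coeFn_sub p q] with x hx
        rw [hx, Pi.sub_apply, sub_mul])
    rw [h1, integral_sub (ht.integrable_mul p) (ht.integrable_mul q)]
    have h2 := hp η ht
    rw [hq η ht] at h2
    linarith

theorem IsWeakPartial.ae_eq_partialDeriv (hΩ : IsOpen Ω) {i : Fin N} {v p : L2 Ω}
    {φ : Euc N → ℝ} (hφ : IsTest Ω φ) (hv : v =ᵐ[volume.restrict Ω] φ)
    (hp : IsWeakPartial Ω i v p) : p =ᵐ[volume.restrict Ω] partialDeriv i φ := by
  have hm := (hφ.pderiv i).memLp 2 (volume.restrict Ω)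
  have hq : IsWeakPartial Ω i v (hm.toLp _) := fun ψ hψ => by
    have e1 : ∫ x in Ω, v x * fderiv ℝ ψ x (stdVec i) = ∫ x in Ω, φ x * partialDeriv i ψ x :=
      integral_congr_ae (by filter_upwards [hv] with x hx; rw [hx]; rfl)
    have e2 : ∫ x in Ω, hm.toLp _ x * ψ x = ∫ x in Ω, partialDeriv i φ x * ψ x :=
      integral_congr_ae (by filter_upwards [hm.coeFn_toLp] with x hx; rw [hx])
    rw [e1, e2, (hψ.pderiv i).setIntegral_mul_eq, hψ.setIntegral_mul_eq,
      hφ.integral_mul_partialDeriv hψ]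
  rw [hp.unique hΩ hq]
  exact hm.coeFn_toLp

end TestFunctions

/-! ### The spaces `H²(Ω)` and `H²₀(Ω)` -/

noncomputable section SobolevSpace

variable {N : ℕ} {Ω : Set (Euc N)}

/-- The projection of a jet on one of its components. -/
def jetProj (Ω : Set (Euc N)) (k : JetIndex N) : H2 Ω →L[ℝ] L2 Ω :=
  (PiLp.proj 2 (fun _ : JetIndex N => L2 Ω) k).comp (H2 Ω).subtypeL

/-- The embedding of `H²(Ω)` in `L²(Ω)`. -/
def toL2L (Ω : Set (Euc N)) : H2 Ω →L[ℝ] L2 Ω := jetProj Ω (.inl ())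

/-- The Laplacian as a bounded operator. -/
def laplacianL (Ω : Set (Euc N)) : H2 Ω →L[ℝ] L2 Ω :=
  ∑ i : Fin N, jetProj Ω (.inr (.inr (i, i)))

theorem toL2L_apply (U : H2 Ω) : toL2L Ω U = toL2 U := rfl

theorem laplacianL_apply (U : H2 Ω) : laplacianL Ω U = laplacian U := by
  simp only [laplacianL, sum_apply]
  rfl

theorem isClosed_isWeakPartial (i : Fin N) :
    IsClosed {vp : L2 Ω × L2 Ω | IsWeakPartial Ω i vp.1 vp.2} := by
  have h : {vp : L2 Ω × L2 Ω | IsWeakPartial Ω i vp.1 vp.2}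
      = ⋂ (φ : Euc N → ℝ) (_ : IsTest Ω φ), {vp : L2 Ω × L2 Ω |
        ∫ x in Ω, partialDeriv i φ x • vp.1 x = - ∫ x in Ω, φ x • vp.2 x} := by
    ext vp
    simp only [mem_iInter, mem_ofPred_eq, smul_eq_mul, mul_comm, IsWeakPartial, partialDeriv]
  rw [h]
  refine isClosed_iInter fun φ => isClosed_iInter fun hφ => isClosed_eq ?_ ?_
  · exact (continuous_integral_smul_Lp ((hφ.pderiv i).memLp 2 _)).comp continuous_fst
  · exact ((continuous_integral_smul_Lp (hφ.memLp 2 _)).comp continuous_snd).neg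

instance completeSpace_H2 : CompleteSpace (H2 Ω) := by
  suffices hcl : IsClosed (H2 Ω : Set (PiLp 2 (fun _ : JetIndex N => L2 Ω))) from
    hcl.completeSpace_coe
  have hc : ∀ k : JetIndex N, Continuous fun U : PiLp 2 (fun _ : JetIndex N => L2 Ω) => U k :=
    fun k => (PiLp.proj (𝕜 := ℝ) 2 (fun _ : JetIndex N => L2 Ω) k).continuous
  have h : (H2 Ω : Set (PiLp 2 (fun _ : JetIndex N => L2 Ω)))
      = (⋂ i, {U | IsWeakPartial Ω i (U (.inl ())) (U (.inr (.inl i)))})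
        ∩ ⋂ (i) (j), {U | IsWeakPartial Ω j (U (.inr (.inl i))) (U (.inr (.inr (i, j))))} := by
    ext U
    simp only [mem_inter_iff, mem_iInter]
    rfl
  rw [h]
  refine (isClosed_iInter fun i => ?_).inter (isClosed_iInter fun i => isClosed_iInter fun j => ?_)
  · exact (isClosed_isWeakPartial i).preimage ((hc _).prodMk (hc _))
  · exact (isClosed_isWeakPartial j).preimage ((hc _).prodMk (hc _))

theorem toL2L_injective (hΩ : IsOpen Ω) : Function.Injective (toL2L Ω) := by
  rw [injective_iff_map_eq_zero]
  rintro ⟨U, hU1, hU2⟩ h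
  have h0 : U (.inl ()) = 0 := h
  have h1 : ∀ i, U (.inr (.inl i)) = 0 := fun i => by
    have := hU1 i
    rw [h0] at this
    exact this.unique hΩ (IsWeakPartial.zero Ω i)
  have h2 : ∀ i j, U (.inr (.inr (i, j))) = 0 := fun i j => by
    have := hU2 i j
    rw [h1] at this
    exact this.unique hΩ (IsWeakPartial.zero Ω j)
  apply Subtype.ext
  ext k : 1
  rcases k with ⟨⟩ | i | ⟨i, j⟩
  · exact h0
  · exact h1 i
  · exact h2 i j

/-- The elements of `H²(Ω)` represented by test functions. -/
def testJets (Ω : Set (Euc N)) : Submodule ℝ (H2 Ω) where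
  carrier := {U : H2 Ω | ∃ φ : Euc N → ℝ, IsTest Ω φ ∧ toL2 U =ᵐ[volume.restrict Ω] φ}
  zero_mem' := ⟨0, IsTest.zero, Lp.coeFn_zero ℝ 2 (volume.restrict Ω)⟩
  add_mem' := by
    rintro U V ⟨φ, hφ, hU⟩ ⟨ψ, hψ, hV⟩
    exact ⟨φ + ψ, hφ.add hψ, (Lp.coeFn_add (toL2 U) (toL2 V)).trans (hU.add hV)⟩
  smul_mem' := by
    rintro c U ⟨φ, hφ, hU⟩
    exact ⟨c • φ, hφ.smul c, (Lp.coeFn_smul c (toL2 U)).trans (hU.const_smul c)⟩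

theorem ae_eq_of_toL2_ae_eq (hΩ : IsOpen Ω) {U : H2 Ω} {φ : Euc N → ℝ} (hφ : IsTest Ω φ)
    (hU : toL2 U =ᵐ[volume.restrict Ω] φ) :
    (∀ i, U.1 (.inr (.inl i)) =ᵐ[volume.restrict Ω] partialDeriv i φ) ∧
      ∀ i j, U.1 (.inr (.inr (i, j))) =ᵐ[volume.restrict Ω]
        partialDeriv j (partialDeriv i φ) := by
  have h1 : ∀ i, U.1 (.inr (.inl i)) =ᵐ[volume.restrict Ω] partialDeriv i φ :=
    fun i => (U.2.1 i).ae_eq_partialDeriv hΩ hφ hU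
  exact ⟨h1, fun i j => (U.2.2 i j).ae_eq_partialDeriv hΩ (hφ.pderiv i) (h1 i)⟩

theorem norm_sq_H2 (U : H2 Ω) : ‖U‖ ^ 2 = ‖toL2 U‖ ^ 2 + (∑ i, ‖U.1 (.inr (.inl i))‖ ^ 2
    + ∑ i, ∑ j, ‖U.1 (.inr (.inr (i, j)))‖ ^ 2) := by
  have h : ‖U‖ = ‖U.1‖ := rfl
  rw [h, PiLp.norm_sq_eq_of_L2, Fintype.sum_sum_type, Fintype.sum_sum_type, Fintype.sum_prod_type]
  simp [toL2]

/-- The second order part of the norm is `‖Δv‖²` and the first order part is `-⟨v, Δv⟩`, which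
Young's inequality bounds by half the sum of the squares; hence `3/2`. The term `‖v‖²` stays on the
right, so no Poincaré inequality enters. -/
theorem norm_sq_le_of_mem_testJets (hΩ : IsOpen Ω) {U : H2 Ω} (hU : U ∈ testJets Ω) :
    ‖U‖ ^ 2 ≤ 3 / 2 * (‖laplacian U‖ ^ 2 + ‖toL2 U‖ ^ 2) := by
  obtain ⟨φ, hφ, hU⟩ := hU
  obtain ⟨h1, h2⟩ := ae_eq_of_toL2_ae_eq hΩ hφ hU
  have hd := fun i => hφ.pderiv i
  have e2 : ∀ i j, ‖U.1 (.inr (.inr (i, j)))‖ ^ 2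
      = inner ℝ (U.1 (.inr (.inr (i, i)))) (U.1 (.inr (.inr (j, j)))) := fun i j => by
    rw [← real_inner_self_eq_norm_sq, ((hd i).pderiv j).inner_eq (h2 i j) (h2 i j),
      ((hd j).pderiv j).inner_eq (h2 i i) (h2 j j), hφ.integral_hessian_sq]
  have e1 : ∀ i, ‖U.1 (.inr (.inl i))‖ ^ 2
      = - inner ℝ (toL2 U) (U.1 (.inr (.inr (i, i)))) := fun i => by
    rw [← real_inner_self_eq_norm_sq, (hd i).inner_eq (h1 i) (h1 i),
      ((hd i).pderiv i).inner_eq hU (h2 i i), hφ.integral_mul_partialDeriv (hd i), neg_neg]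
  have s2 : ∑ i, ∑ j, ‖U.1 (.inr (.inr (i, j)))‖ ^ 2 = ‖laplacian U‖ ^ 2 := by
    simp_rw [e2, laplacian, ← real_inner_self_eq_norm_sq, sum_inner, inner_sum]
  have s1 : ∑ i, ‖U.1 (.inr (.inl i))‖ ^ 2 = - inner ℝ (toL2 U) (laplacian U) := by
    simp_rw [e1, laplacian, inner_sum, Finset.sum_neg_distrib]
  rw [norm_sq_H2, s1, s2]
  have h3 := neg_le_of_abs_le (abs_real_inner_le_norm (toL2 U) (laplacian U))
  nlinarith [sq_nonneg (‖toL2 U‖ - ‖laplacian U‖)]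

theorem norm_sq_le_of_mem_H20 (hΩ : IsOpen Ω) {U : H2 Ω} (hU : U ∈ H20 Ω) :
    ‖U‖ ^ 2 ≤ 3 / 2 * (‖laplacian U‖ ^ 2 + ‖toL2 U‖ ^ 2) := by
  have hcl : IsClosed {U : H2 Ω | ‖U‖ ^ 2 ≤ 3 / 2 * (‖laplacian U‖ ^ 2 + ‖toL2 U‖ ^ 2)} := by
    simp_rw [← laplacianL_apply, ← toL2L_apply]
    exact isClosed_le (by fun_prop) (by fun_prop)
  exact closure_minimal (fun V hV => norm_sq_le_of_mem_testJets hΩ hV) hcl hU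

end SobolevSpace

/-! ### Sobolev embedding in dimension at most three -/

noncomputable section SobolevEmbedding

open scoped SchwartzMap FourierTransform Laplacian LineDeriv
open SchwartzMap

theorem integral_mul_le_sqrt_mul_sqrt {α : Type*} [MeasurableSpace α] {μ : Measure α}
    {f g : α → ℝ} (hf : MemLp f 2 μ) (hg : MemLp g 2 μ) :
    ∫ x, f x * g x ∂μ ≤ √(∫ x, f x ^ 2 ∂μ) * √(∫ x, g x ^ 2 ∂μ) := by
  have hn : ∀ {k : α → ℝ} (hk : MemLp k 2 μ), ‖hk.toLp k‖ = √(∫ x, k x ^ 2 ∂μ) := by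
    intro k hk
    rw [← Real.sqrt_sq (norm_nonneg (hk.toLp k)), norm_sq_Lp_two]
    congr 1
    refine integral_congr_ae ?_
    filter_upwards [hk.coeFn_toLp] with x hx
    rw [hx, Real.norm_eq_abs, sq_abs]
  rw [← hn hf, ← hn hg]
  refine le_trans (le_of_eq ?_) (real_inner_le_norm (hf.toLp f) (hg.toLp g))
  rw [L2.inner_def]
  refine integral_congr_ae ?_
  filter_upwards [hf.coeFn_toLp, hg.coeFn_toLp] with x h1 h2
  rw [h1, h2]
  exact mul_comm _ _

variable {N : ℕ}

theorem fourier_sub_laplacian (f : 𝓢(Euc N, ℂ)) (ξ : Euc N) :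
    𝓕 (f - Δ f) ξ = (1 + (2 * Real.pi) ^ 2 * ‖ξ‖ ^ 2 : ℝ) • 𝓕 f ξ := by
  rw [sub_eq_add_neg, FourierTransform.fourier_add, FourierTransform.fourier_neg,
    laplacian_eq_fourierMultiplierCLM, fourierMultiplierCLM_apply,
    FourierTransform.fourier_smul, FourierTransform.fourier_fourierInv_eq]
  rw [add_apply, neg_apply, smul_apply, smulLeftCLM_apply_apply (by fun_prop)]
  module

/-- The weight `(1 + 4 π² |ξ|²)⁻¹` is square integrable in dimension at most three. -/
theorem memLp_fourierWeight (hN : N ≤ 3) :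
    MemLp (fun ξ : Euc N => (1 + (2 * Real.pi) ^ 2 * ‖ξ‖ ^ 2)⁻¹) 2 volume := by
  have hpos : ∀ ξ : Euc N, 0 < 1 + (2 * Real.pi) ^ 2 * ‖ξ‖ ^ 2 := fun ξ => by positivity
  have hcont : Continuous fun ξ : Euc N => (1 + (2 * Real.pi) ^ 2 * ‖ξ‖ ^ 2)⁻¹ :=
    Continuous.inv₀ (by fun_prop) fun ξ => (hpos ξ).ne'
  rw [memLp_two_iff_integrable_sq hcont.aestronglyMeasurable]
  -- The squared weight decays like `|ξ|⁻⁴`, which is integrable at infinity exactly when `N < 4`.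
  have hr : (Module.finrank ℝ (Euc N) : ℝ) < 4 := by
    rw [finrank_euclideanSpace_fin]
    exact_mod_cast Nat.lt_succ_of_le hN
  refine (integrable_rpow_neg_one_add_norm_sq (μ := volume) hr).mono'
    (hcont.pow 2).aestronglyMeasurable (Eventually.of_forall fun ξ => ?_)
  have h1 : 1 + ‖ξ‖ ^ 2 ≤ 1 + (2 * Real.pi) ^ 2 * ‖ξ‖ ^ 2 := by
    have : 1 ≤ (2 * Real.pi) ^ 2 := by nlinarith [Real.pi_gt_three]
    nlinarith [sq_nonneg ‖ξ‖]
  have h2 : (1 + ‖ξ‖ ^ 2) ^ (-(4 : ℝ) / 2) = ((1 + ‖ξ‖ ^ 2)⁻¹) ^ 2 := by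
    rw [show (-(4 : ℝ) / 2) = -((2 : ℕ) : ℝ) by norm_num, Real.rpow_neg (by positivity),
      Real.rpow_natCast, inv_pow]
  rw [h2, Real.norm_of_nonneg (by positivity)]
  gcongr

/-- By Fourier inversion `|f|` is at most the `L¹` norm of its transform. The latter is the weight
times the transform of `f - Δf`, so Cauchy–Schwarz and Plancherel conclude. -/
theorem SchwartzMap.norm_apply_le_of_dim_le_three (hN : N ≤ 3) :
    ∃ C, 0 ≤ C ∧ ∀ (f : 𝓢(Euc N, ℂ)) (x : Euc N),
      ‖f x‖ ≤ C * √(∫ y, ‖(f - Δ f) y‖ ^ 2) := by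
  refine ⟨√(∫ ξ : Euc N, ((1 + (2 * Real.pi) ^ 2 * ‖ξ‖ ^ 2)⁻¹) ^ 2), Real.sqrt_nonneg _,
    fun f x => ?_⟩
  have h1 : ‖f x‖ ≤ ∫ ξ, ‖𝓕 f ξ‖ := by
    have h2 : f x = 𝓕 (𝓕 f) (-x) := by
      conv_lhs => rw [← FourierTransform.fourierInv_fourier_eq (F := 𝓢(Euc N, ℂ)) f]
      rw [fourierInv_coe, fourier_coe (𝓕 f), Real.fourierInv_eq_fourier_neg]
    rw [h2, ← norm_toLp_one]
    exact norm_fourier_apply_le_toLp_one _ _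
  have h3 : ∀ ξ, ‖𝓕 f ξ‖ = (1 + (2 * Real.pi) ^ 2 * ‖ξ‖ ^ 2)⁻¹ * ‖𝓕 (f - Δ f) ξ‖ := fun ξ => by
    have hpos : 0 < 1 + (2 * Real.pi) ^ 2 * ‖ξ‖ ^ 2 := by positivity
    rw [fourier_sub_laplacian, norm_smul, Real.norm_of_nonneg hpos.le, inv_mul_cancel_left₀ hpos.ne']
  rw [← integral_norm_sq_fourier]
  refine h1.trans ?_
  simp_rw [h3]
  exact integral_mul_le_sqrt_mul_sqrt (memLp_fourierWeight hN) ((𝓕 (f - Δ f)).memLp 2 volume).norm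

variable {Ω : Set (Euc N)}

theorem IsTest.sum {ι : Type*} (s : Finset ι) {φ : ι → Euc N → ℝ} (h : ∀ i, IsTest Ω (φ i)) :
    IsTest Ω (∑ i ∈ s, φ i) := by
  classical
  induction s using Finset.induction_on with
  | empty => simpa using IsTest.zero
  | insert i s hi ih => rw [Finset.sum_insert hi]; exact (h i).add ih

theorem IsTest.sub {φ ψ : Euc N → ℝ} (h : IsTest Ω φ) (h' : IsTest Ω ψ) : IsTest Ω (φ - ψ) := by
  simpa [sub_eq_add_neg] using h.add (h'.smul (-1))

theorem Lp_sum_ae_eq {α ι : Type*} [MeasurableSpace α] {μ : Measure α} (s : Finset ι)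
    {v : ι → Lp ℝ 2 μ} {φ : ι → α → ℝ} (h : ∀ i, v i =ᵐ[μ] φ i) :
    ↑(∑ i ∈ s, v i) =ᵐ[μ] ∑ i ∈ s, φ i := by
  classical
  induction s using Finset.induction_on with
  | empty => simpa using Lp.coeFn_zero ℝ 2 μ
  | insert i s hi ih =>
    rw [Finset.sum_insert hi, Finset.sum_insert hi]
    exact (Lp.coeFn_add _ _).trans ((h i).add ih)

/-- Sobolev's inequality for test functions in dimension at most three. -/
theorem exists_abs_le_mul_norm_H2 (hN : N ≤ 3) (hΩ : IsOpen Ω) :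
    ∃ C, 0 ≤ C ∧ ∀ (U : H2 Ω) (φ : Euc N → ℝ), IsTest Ω φ → toL2 U =ᵐ[volume.restrict Ω] φ →
      ∀ x, |φ x| ≤ C * ‖U‖ := by
  obtain ⟨C, hC, hS⟩ := SchwartzMap.norm_apply_le_of_dim_le_three hN
  refine ⟨C * ‖toL2L Ω - laplacianL Ω‖, by positivity, fun U φ hφ hU x => ?_⟩
  have hc : HasCompactSupport fun y => (φ y : ℂ) := hφ.compact.comp_left Complex.ofReal_zero
  have hs : ContDiff ℝ ∞ fun y => (φ y : ℂ) := Complex.ofRealCLM.contDiff.comp hφ.smooth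
  set f : 𝓢(Euc N, ℂ) := hc.toSchwartzMap hs with hf
  set ψ : Euc N → ℝ := φ - ∑ i, partialDeriv i (partialDeriv i φ) with hψ
  have hψt : IsTest Ω ψ := hφ.sub (IsTest.sum _ fun i => (hφ.pderiv i).pderiv i)
  have hpartial : ∀ (g : 𝓢(Euc N, ℂ)) (χ : Euc N → ℝ), Differentiable ℝ χ →
      (∀ y, g y = (χ y : ℂ)) → ∀ (i : Fin N) y,
      (∂_{EuclideanSpace.basisFun (Fin N) ℝ i} g) y = ((partialDeriv i χ y : ℝ) : ℂ) := by
    intro g χ hχ hg i y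
    rw [lineDerivOp_apply_eq_fderiv, show (g : Euc N → ℂ) = fun z => (χ z : ℂ) from funext hg]
    have := (Complex.ofRealCLM.hasFDerivAt.comp y (hχ y).hasFDerivAt).fderiv
    change fderiv ℝ (Complex.ofRealCLM ∘ χ) y _ = _
    rw [this]
    simp [partialDeriv, stdVec]
  have hh : ∀ y, (f - Δ f) y = (ψ y : ℂ) := fun y => by
    rw [sub_apply, laplacian_eq_sum (EuclideanSpace.basisFun (Fin N) ℝ), hψ, sum_apply]
    have h1 : ∀ i, (∂_{EuclideanSpace.basisFun (Fin N) ℝ i}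
        (∂_{EuclideanSpace.basisFun (Fin N) ℝ i} f)) y
        = ((partialDeriv i (partialDeriv i φ) y : ℝ) : ℂ) := fun i =>
      hpartial _ _ ((hφ.pderiv i).smooth.differentiable (by simp))
        (hpartial f φ (hφ.smooth.differentiable (by simp)) (fun _ => rfl) i) i y
    simp_rw [h1]
    simp [hf]
  have hae : (toL2L Ω - laplacianL Ω) U =ᵐ[volume.restrict Ω] ψ := by
    rw [_root_.sub_apply, toL2L_apply, laplacianL_apply]
    obtain ⟨-, h2⟩ := ae_eq_of_toL2_ae_eq hΩ hφ hU
    have h3 : laplacian U =ᵐ[volume.restrict Ω] ∑ i, partialDeriv i (partialDeriv i φ) := by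
      exact Lp_sum_ae_eq _ fun i => h2 i i
    exact (Lp.coeFn_sub _ _).trans (hU.sub h3)
  -- `φ - Δφ` is supported in `Ω`, so its norm over the whole space is the norm in `L²(Ω)` of the
  -- jet expression.
  have h4 : ∫ y, ‖(f - Δ f) y‖ ^ 2 = ‖(toL2L Ω - laplacianL Ω) U‖ ^ 2 := by
    rw [← real_inner_self_eq_norm_sq, hψt.inner_eq hae hae]
    refine integral_congr_ae (Eventually.of_forall fun y => ?_)
    simp [hh, sq]
  have h5 := hS f x
  rw [h4, Real.sqrt_sq (norm_nonneg _)] at h5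
  calc |φ x| = ‖f x‖ := by simp [hf]
    _ ≤ C * ‖(toL2L Ω - laplacianL Ω) U‖ := h5
    _ ≤ C * (‖toL2L Ω - laplacianL Ω‖ * ‖U‖) := by
        gcongr; exact ContinuousLinearMap.le_opNorm _ _
    _ = _ := by ring

/-- The Sobolev embedding `H²₀(Ω) ⊂ C(ℝᴺ)` in dimension at most three. -/
theorem exists_continuous_ae_eq_of_mem_H20 (hN : N ≤ 3) (hΩ : IsOpen Ω) {U : H2 Ω}
    (hU : U ∈ H20 Ω) : ∃ v : Euc N → ℝ, Continuous v ∧ toL2 U =ᵐ[volume.restrict Ω] v := by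
  obtain ⟨C, hC, hS⟩ := exists_abs_le_mul_norm_H2 hN hΩ
  obtain ⟨V, hV, hlim⟩ := mem_closure_iff_seq_limit.1 hU
  choose φ hφ hφV using hV
  have hdiff : ∀ m n x, |φ m x - φ n x| ≤ C * ‖V m - V n‖ := fun m n x =>
    hS (V m - V n) (φ m - φ n) ((hφ m).sub (hφ n))
      ((Lp.coeFn_sub (toL2 (V m)) (toL2 (V n))).trans ((hφV m).sub (hφV n))) x
  have hcauchy : UniformCauchySeqOn φ atTop univ := by
    rw [Metric.uniformCauchySeqOn_iff]
    intro ε hε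
    obtain ⟨n₀, hn₀⟩ := Metric.cauchySeq_iff.1 hlim.cauchySeq (ε / (C + 1)) (by positivity)
    refine ⟨n₀, fun m hm n hn x _ => ?_⟩
    have h1 := hn₀ m hm n hn
    rw [dist_eq_norm, lt_div_iff₀ (by positivity)] at h1
    rw [Real.dist_eq]
    nlinarith [hdiff m n x, norm_nonneg (V m - V n)]
  have hpt : ∀ x, ∃ c, Tendsto (fun n => φ n x) atTop (𝓝 c) := fun x =>
    cauchySeq_tendsto_of_complete (hcauchy.cauchySeq (mem_univ x))
  choose v hv using hpt
  have hunif := hcauchy.tendstoUniformlyOn_of_tendsto fun x _ => hv x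
  refine ⟨v, ?_, ?_⟩
  · rw [← continuousOn_univ]
    exact hunif.continuousOn (Frequently.of_forall fun n => (hφ n).continuous.continuousOn)
  · have hL2 : Tendsto (fun n => toL2 (V n)) atTop (𝓝 (toL2 U)) :=
      ((toL2L Ω).continuous.tendsto U).comp hlim
    -- The uniform limit `v` is identified with `U` along a subsequence converging almost
    -- everywhere.
    obtain ⟨ns, hns, hae⟩ := (tendstoInMeasure_of_tendsto_Lp hL2).exists_seq_tendsto_ae
    filter_upwards [hae, ae_all_iff.2 hφV] with x h1 h2
    refine tendsto_nhds_unique h1 ?_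
    simp_rw [h2]
    exact (hv x).comp hns.tendsto_atTop

end SobolevEmbedding

/-! ### Constrained quadratic minimization as a projection -/

noncomputable section ConstrainedMinimization

variable {H X Y : Type*} [NormedAddCommGroup H] [InnerProductSpace ℝ H]
  [NormedAddCommGroup X] [InnerProductSpace ℝ X] [NormedAddCommGroup Y] [InnerProductSpace ℝ Y]

/-- The operator `V ↦ (L V, c J V)`. -/
def pairMap (L : H →L[ℝ] Y) (J : H →L[ℝ] X) (c : ℝ) : H →L[ℝ] WithLp 2 (Y × X) :=
  ((WithLp.prodContinuousLinearEquiv 2 ℝ Y X).symm : (Y × X) →L[ℝ] WithLp 2 (Y × X)).comp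
    (L.prod (c • J))

theorem norm_sq_pairMap (L : H →L[ℝ] Y) (J : H →L[ℝ] X) (c : ℝ) (V : H) :
    ‖pairMap L J c V‖ ^ 2 = ‖L V‖ ^ 2 + c ^ 2 * ‖J V‖ ^ 2 := by
  rw [WithLp.prod_norm_sq_eq_of_L2]
  change ‖L V‖ ^ 2 + ‖c • J V‖ ^ 2 = _
  rw [norm_smul, mul_pow, Real.norm_eq_abs, sq_abs]

theorem norm_sq_sub_pairMap (L : H →L[ℝ] Y) (J : H →L[ℝ] X) (c : ℝ) (w : X) (V : H) :
    ‖WithLp.toLp 2 ((0 : Y), c • w) - pairMap L J c V‖ ^ 2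
      = ‖L V‖ ^ 2 + c ^ 2 * ‖J V - w‖ ^ 2 := by
  rw [WithLp.prod_norm_sq_eq_of_L2]
  change ‖0 - L V‖ ^ 2 + ‖c • w - c • J V‖ ^ 2 = _
  rw [zero_sub, norm_neg, ← smul_sub, norm_smul, mul_pow, Real.norm_eq_abs, sq_abs, norm_sub_rev]

theorem inner_sub_pairMap (L : H →L[ℝ] Y) (J : H →L[ℝ] X) (c : ℝ) (w : X) (V W : H) :
    inner ℝ (WithLp.toLp 2 ((0 : Y), c • w) - pairMap L J c V) (pairMap L J c W - pairMap L J c V)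
      = - inner ℝ (L V) (L W - L V) + c ^ 2 * inner ℝ (w - J V) (J W - J V) := by
  rw [WithLp.prod_inner_apply]
  change inner ℝ (0 - L V) (L W - L V) + inner ℝ (c • w - c • J V) (c • J W - c • J V) = _
  rw [zero_sub, inner_neg_left, ← smul_sub, ← smul_sub, real_inner_smul_left,
    real_inner_smul_right]
  ring

variable {L : H →L[ℝ] Y} {J : H →L[ℝ] X} {K : Set H} {c C : ℝ}

/-- The functional is the squared distance from `(0, c w)` to `(L V, c J V)`. Coercivity on
differences makes this map antilipschitz on `K`, so the image of `K` is complete as well as convex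
and has a nearest point. -/
theorem exists_constrained_minimizer [CompleteSpace H] (hK : IsClosed K) (hconv : Convex ℝ K)
    (hne : K.Nonempty) (hc : 0 < c) (hC : 0 ≤ C)
    (hcoer : ∀ V ∈ K, ∀ W ∈ K, ‖V - W‖ ^ 2 ≤ C * (‖L (V - W)‖ ^ 2 + ‖J (V - W)‖ ^ 2)) (w : X) :
    ∃ V ∈ K, ∀ W ∈ K, ‖L V‖ ^ 2 + c ^ 2 * ‖J V - w‖ ^ 2 ≤ ‖L W‖ ^ 2 + c ^ 2 * ‖J W - w‖ ^ 2 := by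
  set S := pairMap L J c with hS
  have hanti : AntilipschitzWith (√(C * (1 + (c ^ 2)⁻¹))).toNNReal (K.domRestrict S) := by
    refine AntilipschitzWith.of_le_mul_dist fun V W => ?_
    rw [Real.coe_toNNReal _ (Real.sqrt_nonneg _), Subtype.dist_eq, dist_eq_norm, dist_eq_norm]
    change ‖(V : H) - W‖ ≤ _ * ‖S V - S W‖
    rw [← map_sub, ← Real.sqrt_sq (norm_nonneg (S _)), ← Real.sqrt_mul (by positivity)]
    refine Real.le_sqrt_of_sq_le ((hcoer _ V.2 _ W.2).trans ?_)
    rw [hS, norm_sq_pairMap, mul_assoc]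
    refine mul_le_mul_of_nonneg_left ?_ hC
    set p := ‖L ((V : H) - W)‖ ^ 2
    set q := ‖J ((V : H) - W)‖ ^ 2
    have hp : 0 ≤ p := sq_nonneg _
    have hq : 0 ≤ q := sq_nonneg _
    have h1 : (1 + (c ^ 2)⁻¹) * (p + c ^ 2 * q) = p + q + (c ^ 2 * q + (c ^ 2)⁻¹ * p) := by
      field_simp; ring
    rw [h1]
    have : 0 ≤ c ^ 2 * q + (c ^ 2)⁻¹ * p := by positivity
    linarith
  have hunif : UniformContinuous (K.domRestrict S) :=
    S.uniformContinuous.comp uniformContinuous_subtype_val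
  have hcomp : IsComplete (S '' K) := by
    have := hK.completeSpace_coe
    rw [← Set.range_domRestrict]
    exact hanti.isComplete_range hunif
  obtain ⟨_, ⟨V, hV, rfl⟩, hmin⟩ := exists_norm_eq_iInf_of_complete_convex (hne.image S) hcomp
    (hconv.linear_image (S : H →ₗ[ℝ] WithLp 2 (Y × X))) (WithLp.toLp 2 ((0 : Y), c • w))
  refine ⟨V, hV, fun W hW => ?_⟩
  rw [← norm_sq_sub_pairMap, ← norm_sq_sub_pairMap]
  refine pow_le_pow_left₀ (norm_nonneg _) ?_ 2
  rw [← hS, hmin]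
  exact ciInf_le ⟨0, forall_mem_range.2 fun _ => norm_nonneg _⟩
    (⟨S W, W, hW, rfl⟩ : (S '' K : Set (WithLp 2 (Y × X))))

/-- The obtuse angle property of the projection, with `⟨L V, L W⟩ ≤ ½‖L V‖² + ½‖L W‖²` to restore
the energies. -/
theorem variational_inequality_of_minimizer (hconv : Convex ℝ K) {w : X} {V : H} (hV : V ∈ K)
    (hmin : ∀ W ∈ K, ‖L V‖ ^ 2 + c ^ 2 * ‖J V - w‖ ^ 2 ≤ ‖L W‖ ^ 2 + c ^ 2 * ‖J W - w‖ ^ 2)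
    {W : H} (hW : W ∈ K) :
    1 / 2 * ‖L V‖ ^ 2 ≤ 1 / 2 * ‖L W‖ ^ 2 + inner ℝ (c ^ 2 • (J V - w)) (J W - J V) := by
  set S := pairMap L J c with hS
  have hne : Nonempty (S '' K) := ⟨⟨S V, V, hV, rfl⟩⟩
  have heq : ‖WithLp.toLp 2 ((0 : Y), c • w) - S V‖
      = ⨅ z : S '' K, ‖WithLp.toLp 2 ((0 : Y), c • w) - z‖ := by
    refine le_antisymm (le_ciInf ?_) (ciInf_le ⟨0, forall_mem_range.2 fun _ => norm_nonneg _⟩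
      (⟨S V, V, hV, rfl⟩ : (S '' K : Set (WithLp 2 (Y × X)))))
    rintro ⟨_, Z, hZ, rfl⟩
    refine le_of_sq_le_sq ?_ (norm_nonneg _)
    rw [hS, norm_sq_sub_pairMap, norm_sq_sub_pairMap]
    exact hmin Z hZ
  have h1 : inner ℝ (WithLp.toLp 2 ((0 : Y), c • w) - S V) (S W - S V) ≤ 0 :=
    (norm_eq_iInf_iff_real_inner_le_zero
      (hconv.linear_image (S : H →ₗ[ℝ] WithLp 2 (Y × X))) ⟨V, hV, rfl⟩).1 heq (S W) ⟨W, hW, rfl⟩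
  rw [hS, inner_sub_pairMap] at h1
  have h2 : inner ℝ (c ^ 2 • (J V - w)) (J W - J V) = - (c ^ 2 * inner ℝ (w - J V) (J W - J V)) := by
    rw [real_inner_smul_left, ← neg_sub w, inner_neg_left]; ring
  rw [inner_sub_right, real_inner_self_eq_norm_sq] at h1
  rw [h2]
  nlinarith [real_inner_le_norm (L V) (L W), sq_nonneg (‖L V‖ - ‖L W‖)]

end ConstrainedMinimization

/-! ### The obstacle problem as a discrete flow -/

noncomputable section ObstacleProblem

variable {N : ℕ} {Ω : Set (Euc N)} {f g : Euc N → ℝ}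

theorem integral_sq_eq_norm_sq (v : L2 Ω) : ∫ x in Ω, (v x) ^ 2 = ‖v‖ ^ 2 := by
  rw [norm_sq_Lp_two]
  simp_rw [Real.norm_eq_abs, sq_abs]

theorem energy_eq (V : H2 Ω) : energy V = 1 / 2 * ‖laplacianL Ω V‖ ^ 2 := by
  rw [energy, integral_sq_eq_norm_sq, laplacianL_apply]

theorem energy_nonneg (V : H2 Ω) : 0 ≤ energy V := by
  rw [energy_eq]; positivity

/-- Fits the general minimization problem with `c = τ^{-1/2}`, so that `c² = 1/τ`. -/
theorem stepFunctional_eq {τ : ℝ} (hτ : 0 < τ) (W V : H2 Ω) :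
    stepFunctional τ W V
      = 1 / 2 * (‖laplacianL Ω V‖ ^ 2 + (√τ)⁻¹ ^ 2 * ‖toL2L Ω V - toL2L Ω W‖ ^ 2) := by
  have h : ∫ x in Ω, (toL2 V x - toL2 W x) ^ 2 = ‖toL2 V - toL2 W‖ ^ 2 := by
    rw [← integral_sq_eq_norm_sq]
    refine integral_congr_ae ?_
    filter_upwards [Lp.coeFn_sub (toL2 V) (toL2 W)] with x hx
    rw [hx, Pi.sub_apply]
  rw [stepFunctional, energy_eq, h, inv_pow, Real.sq_sqrt hτ.le, toL2L_apply, toL2L_apply]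
  field_simp

theorem isClosed_obstacleSet (Ω : Set (Euc N)) (f g : Euc N → ℝ) :
    IsClosed (obstacleSet Ω f g) := by
  refine IsClosed.inter isClosed_closure (IsSeqClosed.isClosed fun V U hV hlim => ?_)
  have hL2 : Tendsto (fun n => toL2 (V n)) atTop (𝓝 (toL2 U)) :=
    ((toL2L Ω).continuous.tendsto U).comp hlim
  obtain ⟨ns, -, hae⟩ := (tendstoInMeasure_of_tendsto_Lp hL2).exists_seq_tendsto_ae
  filter_upwards [hae, ae_all_iff.2 hV] with x h1 h2
  exact ⟨ge_of_tendsto' h1 fun n => (h2 (ns n)).1, le_of_tendsto' h1 fun n => (h2 (ns n)).2⟩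

theorem convex_obstacleSet (Ω : Set (Euc N)) (f g : Euc N → ℝ) :
    Convex ℝ (obstacleSet Ω f g) := by
  -- `H20 Ω` is by definition the closure of the subspace `testJets Ω`, hence itself a subspace.
  refine Convex.inter (testJets Ω).topologicalClosure.convex ?_
  intro U hU V hV a b ha hb hab
  filter_upwards [hU, hV, Lp.coeFn_add (a • toL2 U) (b • toL2 V), Lp.coeFn_smul a (toL2 U),
    Lp.coeFn_smul b (toL2 V)] with x h1 h2 h3 h4 h5
  have h6 : toL2 (a • U + b • V) x = a • toL2 U x + b • toL2 V x := by
    change (a • toL2 U + b • toL2 V : L2 Ω) x = _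
    rw [h3, Pi.add_apply, h4, h5, Pi.smul_apply, Pi.smul_apply]
  exact h6 ▸ convex_Icc (f x) (g x) h1 h2 ha hb hab

theorem sub_mem_H20 {U V : H2 Ω} (hU : U ∈ H20 Ω) (hV : V ∈ H20 Ω) : U - V ∈ H20 Ω :=
  (testJets Ω).topologicalClosure.sub_mem hU hV

theorem stepMinimizer_spec (hΩ : IsOpen Ω) {τ : ℝ} (hτ : 0 < τ)
    (hne : (obstacleSet Ω f g).Nonempty) (W : H2 Ω) :
    stepMinimizer f g τ W ∈ obstacleSet Ω f g ∧ ∀ V ∈ obstacleSet Ω f g,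
      stepFunctional τ W (stepMinimizer f g τ W) ≤ stepFunctional τ W V := by
  refine Classical.epsilon_spec (p := fun V => V ∈ obstacleSet Ω f g ∧
    ∀ V' ∈ obstacleSet Ω f g, stepFunctional τ W V ≤ stepFunctional τ W V') ?_
  obtain ⟨V, hV, hmin⟩ := exists_constrained_minimizer (L := laplacianL Ω) (J := toL2L Ω)
    (isClosed_obstacleSet Ω f g) (convex_obstacleSet Ω f g) hne
    (inv_pos.2 (Real.sqrt_pos.2 hτ)) (show (0 : ℝ) ≤ 3 / 2 by norm_num)
    (fun U hU V hV => by
      rw [laplacianL_apply, toL2L_apply]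
      exact norm_sq_le_of_mem_H20 hΩ (sub_mem_H20 hU.1 hV.1)) (toL2L Ω W)
  refine ⟨V, hV, fun V' hV' => ?_⟩
  rw [stepFunctional_eq hτ, stepFunctional_eq hτ]
  have := hmin V' hV'
  linarith

theorem isDiscreteFlow_discreteSol (hΩ : IsOpen Ω) {u₀ : H2 Ω} (hu₀ : u₀ ∈ obstacleSet Ω f g)
    {τ : ℝ} (hτ : 0 < τ) :
    IsDiscreteFlow (obstacleSet Ω f g) (toL2L Ω) energy τ (discreteSol f g u₀ τ) where
  mem i := by
    cases i with
    | zero => exact hu₀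
    | succ i => exact (stepMinimizer_spec hΩ hτ ⟨u₀, hu₀⟩ _).1
  evi i V hV := by
    obtain ⟨h1, h2⟩ := stepMinimizer_spec (f := f) (g := g) hΩ hτ ⟨u₀, hu₀⟩
      (discreteSol f g u₀ τ i)
    have h3 := variational_inequality_of_minimizer (L := laplacianL Ω) (J := toL2L Ω)
      (c := (√τ)⁻¹) (w := toL2L Ω (discreteSol f g u₀ τ i)) (convex_obstacleSet Ω f g) h1
      (fun W hW => by
        have := h2 W hW
        rw [stepFunctional_eq hτ, stepFunctional_eq hτ] at this
        linarith) hV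
    rw [inv_pow, Real.sq_sqrt hτ.le, ← energy_eq, ← energy_eq] at h3
    exact h3

theorem convexOn_energy {K : Set (H2 Ω)} (hK : Convex ℝ K) : ConvexOn ℝ K energy := by
  have h1 : ConvexOn ℝ univ fun v : L2 Ω => ‖v‖ ^ 2 :=
    (convexOn_norm convex_univ).pow (fun _ _ => norm_nonneg _) 2
  have h2 := (h1.comp_linearMap (laplacianL Ω : H2 Ω →ₗ[ℝ] L2 Ω)).smul
    (show (0 : ℝ) ≤ 1 / 2 by norm_num)
  refine (h2.subset (subset_univ K) hK).congr fun V _ => ?_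
  rw [energy_eq]
  rfl

theorem exists_isFlowLimit (hΩ : IsOpen Ω) {u₀ : H2 Ω} (hu₀ : u₀ ∈ obstacleSet Ω f g) :
    ∃ u : ℝ → L2 Ω, IsFlowLimit (obstacleSet Ω f g) (toL2L Ω) energy
      (fun τ => discreteSol f g u₀ τ) u₀ u 3 := by
  obtain ⟨u, h1, h2⟩ := exists_limit_of_isDiscreteFlow
    (fun τ hτ => isDiscreteFlow_discreteSol hΩ hu₀ hτ) (fun _ => rfl) energy_nonneg
  refine ⟨u, ⟨isClosed_obstacleSet Ω f g, convex_obstacleSet Ω f g, toL2L_injective hΩ,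
    energy_nonneg, convexOn_energy (convex_obstacleSet Ω f g), fun V hV => ?_, by norm_num,
    fun τ hτ => isDiscreteFlow_discreteSol hΩ hu₀ hτ, fun _ => rfl, h1, h2⟩⟩
  have h := norm_sq_le_of_mem_H20 hΩ hV.1
  rw [energy_eq, laplacianL_apply, toL2L_apply]
  -- `‖ΔV‖² = 2E(V)`, so the factor `3/2` becomes `3`.
  nlinarith [sq_nonneg ‖toL2 V‖]

/-- `max v w` and `w` are continuous on the open set `U` and agree almost everywhere there, hence
everywhere in `U`. -/
theorem le_on_of_ae_le {U : Set (Euc N)} (hU : IsOpen U) {v w : Euc N → ℝ}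
    (hv : ContinuousOn v U) (hw : ContinuousOn w U) (h : v ≤ᵐ[volume.restrict U] w) :
    ∀ x ∈ U, v x ≤ w x := by
  have h1 : (fun x => max (v x) (w x)) =ᵐ[volume.restrict U] w := by
    filter_upwards [h] with x hx
    exact max_eq_right hx
  intro x hx
  exact max_eq_right_iff.1 (Measure.eqOn_open_of_ae_eq h1 hU (hv.sup hw) hw hx)

theorem exists_continuousOn_between (hN : N ≤ 3) (hΩ : IsOpen Ω) (hf : ContinuousOn f Ω)
    (hg : ContinuousOn g Ω) {V : H2 Ω} (hV : V ∈ obstacleSet Ω f g) :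
    ∃ v : Euc N → ℝ, ContinuousOn v Ω ∧ toL2 V =ᵐ[volume.restrict Ω] v ∧
      ∀ x ∈ Ω, f x ≤ v x ∧ v x ≤ g x := by
  obtain ⟨v, hv, hVv⟩ := exists_continuous_ae_eq_of_mem_H20 hN hΩ hV.1
  have h1 : f ≤ᵐ[volume.restrict Ω] v := by
    filter_upwards [hVv, hV.2] with x h h'
    exact h ▸ h'.1
  have h2 : v ≤ᵐ[volume.restrict Ω] g := by
    filter_upwards [hVv, hV.2] with x h h'
    exact h ▸ h'.2
  exact ⟨v, hv.continuousOn, hVv, fun x hx => ⟨le_on_of_ae_le hΩ hf hv.continuousOn h1 x hx,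
    le_on_of_ae_le hΩ hv.continuousOn hg h2 x hx⟩⟩

end ObstacleProblem

end BiharmonicObstacle


theorem mainTheorem5 (N : ℕ) (hN : 1 ≤ N) (hN3 : N ≤ 3) (Ω : Set (Euc N))
    (hΩ : IsBoundedDomain Ω) (hΩ4 : HasC4Boundary Ω)
    (f g : Euc N → ℝ) (hfg : AreObstacles Ω f g)
    (u₀ : H2 Ω) (hu₀ : u₀ ∈ obstacleSet Ω f g) :
    ∃ u : ℝ → L2 Ω, ∀ T : ℝ, 0 < T →
      MemLinftyH20 T u ∧
      (∃ P : H1Time T (L2 Ω), IsClassOfH1Time P u ∧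
        ∫ t in Ioo 0 T, ∫ x in Ω, (timeDeriv P t x) ^ 2 ≤ 2 * energy u₀) ∧
      (∀ t ∈ Icc (0 : ℝ) T, ∃ v : Euc N → ℝ, ContinuousOn v Ω ∧
        u t =ᵐ[volume.restrict Ω] v ∧ ∀ x ∈ Ω, f x ≤ v x ∧ v x ≤ g x) ∧
      ∃ φ : ℕ → ℕ, StrictMono φ ∧ (∀ k, 1 ≤ φ k) ∧
        WeaklyTendstoL2H2 T (fun k => interpolant f g u₀ T (φ k)) u ∧
        WeaklyTendstoH1Time T (fun k => interpolant f g u₀ T (φ k)) u ∧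
        ∀ α : ℝ≥0, 0 < α → α < 1 / 2 →
          holderNormOn T α u < ⊤ ∧
          Tendsto (fun k => holderNormOn T α (fun t => interpolant f g u₀ T (φ k) t - u t))
            atTop (𝓝 0) := by
  obtain ⟨u, hu⟩ := exists_isFlowLimit hΩ.isOpen hu₀
  refine ⟨u, fun T hT => ?_⟩
  obtain ⟨Q, Q', M, hQ, hQ', hQw⟩ := hu.exists_weaklyTendsto_Lp hT
  obtain ⟨P, P', hP, hP', hE, hPw⟩ := hu.exists_weaklyTendsto_H1Time hT
  -- The whole sequence converges; the shift `k + 1` only excludes `n = 0`. With `n = k + 1`,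
  -- `interpolant` unfolds to `linearInterp` with step `meshSize T k`.
  refine ⟨⟨Q', ?_, ?_⟩, ⟨P', hP', ?_⟩, fun t ht => ?_, fun k => k + 1,
    fun a b hab => Nat.succ_lt_succ hab, fun k => Nat.succ_pos k,
    ⟨Q, Q', hQ, hQ'.mono fun t ht => ht.2.1, hQw⟩, ⟨P, P', hP, hP', hPw⟩,
    fun α _ hα => ⟨hu.holderNormOn_lt_top hT hα, hu.tendsto_holderNormOn hT hα⟩⟩
  · exact memLp_top_of_bound (Lp.aestronglyMeasurable Q') M (hQ'.mono fun t ht => ht.2.2)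
  · exact hQ'.mono fun t ht => ⟨ht.1.1, ht.2.1⟩
  · simp_rw [integral_sq_eq_norm_sq]
    rw [← norm_sq_Lp_two]
    -- The bound obtained is `E(u₀)`, stronger than `2E(u₀)`.
    linarith [energy_nonneg u₀]
  · obtain ⟨M, -, hM⟩ := hu.exists_norm_interp_le T
    obtain ⟨V, hVK, hV, -⟩ := hu.exists_mem_of_nonneg hT hM ht.1 ht.2
    obtain ⟨v, hv, hVv, hle⟩ := exists_continuousOn_between hN3 hΩ.isOpen
      (hfg.contDiffOn_lower.continuousOn.mono subset_closure)
      (hfg.contDiffOn_upper.continuousOn.mono subset_closure) hVK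
    exact ⟨v, hv, hV ▸ hVv, hle⟩
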